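/- **Setting.** Let $M$ be a smooth $n$-manifold with $n\ge 2$, equipped with a conformal class of Riemannian metrics; for metrics $g$ and $\widehat g=\Omega^2g$ in the class ($\Omega>0$ smooth) put $\Upsilon_a=\Omega^{-1}\nabla_a\Omega$. Every $g$ in the class comes with a tensor $\mathrm{P}_{ab}$. If $n\ge3$, it is the Schouten tensor $\mathrm{P}_{ab}=\frac1{n-2}\bigl(R_{ab}-\frac1{2(n-1)}Rg_{ab}\bigr)$. If $n=2$, it is part of the structure (a Möbius structure): a smooth symmetric tensor for each $g$, subject to $\widehat{\mathrm P}_{ab}=\mathrm{P}_{ab}-\nabla_a\Upsilon_b+\Upsilon_a\Upsilon_b-\frac12\Upsilon^c\Upsilon_c\,g_{ab}$. An adjoint tractor at a point is given, in the presence of each metric $g$ of the class, by slots $(\sigma_b,\mu_{bc},\nu,\rho_b)$ with $\mu_{bc}$ skew, where $\sigma_b,\mu_{bc},\nu,\rho_b$ have conformal weights $2,2,0,0$ and, up to these weights, the slots for $g$ and for $\widehat g=\Omega^2g$ are related by $$\widehat\sigma_b=\sigma_b,\quad \widehat\mu_{bc}=\mu_{bc}+2\Upsilon_{[b}\sigma_{c]},\quad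 \widehat\nu=\nu+\Upsilon^b\sigma_b,\quad \widehat\rho_b=\rho_b+\Upsilon^a\mu_{ab}-\Upsilon_b\nu-\Upsilon^a\Upsilon_b\sigma_a+\tfrac12\Upsilon^a\Upsilon_a\sigma_b .$$ These form the adjoint tractor bundle $\mathcal A$. Let $\gamma$ be a smooth oriented curve in $M$ (given by a smooth regular parametrisation by an open interval). For $g$ in the class, let $U^a$ be the unit tangent vector along $\gamma$, $\partial=U^a\nabla_a$ (Levi-Civita connection of $g$), $A_a=\partial U_a$, and let $$J_a=\partial A_a+(A^bA_b+\mathrm P_{bc}U^bU^c)U_a-\mathrm P_{ab}U^b$$ be the normalised jerk; $\gamma$ is a conformal circle if $J_a\equiv0$. The tractor directional derivative $\partial$ along $\gamma$, from sections of $\mathcal A|_\gamma$ to sections of $\mathcal A|_\gamma$ twisted by the densities of weight $-1$ (which are trivialised by $g$), sends the section with slots $(\sigma_b,\mu_{bc},\nu,\rho_b)$ to the one with slots $$\bigl(\partial\sigma_b-U^a\mu_{ab}-\nu U_b,\;\; \partial\mu_{bc}-2U_{[b}\rho_{c]}+2U^a\mathrm P_{a[b}\sigma_{c]},\;\; \partial\nu+U^a\rho_a+U^a\mathrm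 P_a{}^b\sigma_b,\;\; \partial\rho_b-U^a\mathrm P_a{}^c\mu_{bc}-U^a\mathrm P_{ab}\nu\bigr).$$ Let $\mathcal B\subset\mathcal A|_\gamma$ consist of the adjoint tractors whose slots, with respect to every metric $g$ in the class, lie in the span of $$(0,0,0,U_b),\qquad (0,0,1,A_b),\qquad (U_b,\,2U_{[b}A_{c]},\,0,\,0).$$ **Theorem.** All fibres of $\mathcal B$ have dimension $3$. For every metric $g$ in the conformal class, with $\partial$ and $J_a$ computed using $g$: the subbundle $\mathcal B$ is preserved by $\partial$ (that is, $\partial\Phi$ takes values in $\mathcal B$ for every smooth section $\Phi$ of $\mathcal A|_\gamma$ with values in $\mathcal B$) if and only if $J_a\equiv0$ along $\gamma$, i.e. if and only if $\gamma$ is a conformal circle. -/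

import Mathlib

open scoped Manifold ContDiff Topology

set_option maxSynthPendingDepth 3

noncomputable section

namespace ConformalCircles

/-- Coordinate space. -/
abbrev Coord (n : ℕ) : Type := EuclideanSpace ℝ (Fin n)

/-- A smooth Riemannian metric `g_ab` on the `n`-manifold `M`. -/
abbrev Metric (n : ℕ) (M : Type*) [TopologicalSpace M] [ChartedSpace (Coord n) M]
    [IsManifold (𝓡 n) ∞ M] : Type _ :=
  Bundle.ContMDiffRiemannianMetric (𝓡 n) ∞ (Coord n) (fun x : M => TangentSpace (𝓡 n) x)

/-- The tangent space at `x`. -/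
abbrev Tan {n : ℕ} {M : Type*} [TopologicalSpace M] [ChartedSpace (Coord n) M]
    (x : M) : Type := TangentSpace (𝓡 n) x

/-- Covectors at `x`. -/
abbrev Cov {n : ℕ} {M : Type*} [TopologicalSpace M] [ChartedSpace (Coord n) M]
    (x : M) : Type := Tan (n := n) x →L[ℝ] ℝ

/-- Bilinear forms (covariant 2-tensors) at `x`; `B u v` is `B_ab u^a v^b`. -/
abbrev Bil {n : ℕ} {M : Type*} [TopologicalSpace M] [ChartedSpace (Coord n) M]
    (x : M) : Type := Tan (n := n) x →L[ℝ] Tan (n := n) x →L[ℝ] ℝ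

section Pointwise

variable {n : ℕ} {M : Type*} [TopologicalSpace M] [ChartedSpace (Coord n) M]

/-- The bilinear form `2 α_[a β_b] = α_a β_b - α_b β_a`. -/
def wedge {x : M} (α β : Cov (n := n) x) : Bil (n := n) x :=
  α.smulRight β - β.smulRight α

/-- The covector `B_ab v^b`. -/
def contractSnd {x : M} (B : Bil (n := n) x) (v : Tan (n := n) x) : Cov (n := n) x where
  toFun u := B u v
  map_add' u u' := by simp
  map_smul' r u := by simp
  cont := by fun_prop

variable [IsManifold (𝓡 n) ∞ M]

/-- Raising an index: the vector `v` with `g(v, ·) = α`. -/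
def sharp (g : Metric n M) {x : M} (α : Cov (n := n) x) : Tan (n := n) x :=
  (g.inner x).inverse α

/-- The inner product `g^{ab} α_a β_b` of covectors. -/
def coInner (g : Metric n M) {x : M} (α β : Cov (n := n) x) : ℝ := α (sharp g β)

end Pointwise

/-! ### Coordinates, Levi-Civita connection and curvature -/

section Coordinates

variable {n : ℕ} {M : Type*} [TopologicalSpace M] [ChartedSpace (Coord n) M]
  [IsManifold (𝓡 n) ∞ M]

/-- The coordinate frame at `x` of the chart around `x₀` (for `x` in the domain of the chart):
the vector with the given components. -/
def frame (x₀ x : M) : Coord n →L[ℝ] Tan (n := n) x :=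
  (trivializationAt (Coord n) (fun y : M => TangentSpace (𝓡 n) y) x₀).symmL ℝ x

/-- The components of a tangent vector at `x` in the chart around `x₀`; this is the derivative of
the chart, and the inverse of `frame x₀ x`. -/
def components (x₀ x : M) : Tan (n := n) x →L[ℝ] Coord n :=
  (trivializationAt (Coord n) (fun y : M => TangentSpace (𝓡 n) y) x₀).continuousLinearMapAt ℝ x

/-- The components of a covector in the chart around `x₀`. -/
def covComponents (x₀ : M) {x : M} (α : Cov (n := n) x) : Coord n →L[ℝ] ℝ :=
  α.comp (frame x₀ x)

/-- The components of a bilinear form in the chart around `x₀`. -/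
def bilComponents (x₀ : M) {x : M} (B : Bil (n := n) x) : Coord n →L[ℝ] Coord n →L[ℝ] ℝ :=
  (ContinuousLinearMap.precomp ℝ (frame x₀ x)).comp (B.comp (frame x₀ x))

/-- The covector with the given components in the chart around `x₀`. -/
def covOfComponents (x₀ x : M) (α : Coord n →L[ℝ] ℝ) : Cov (n := n) x :=
  α.comp (components x₀ x)

/-- The bilinear form with the given components in the chart around `x₀`. -/
def bilOfComponents (x₀ x : M) (B : Coord n →L[ℝ] Coord n →L[ℝ] ℝ) : Bil (n := n) x :=
  (ContinuousLinearMap.precomp ℝ (components x₀ x)).comp (B.comp (components x₀ x))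

/-- The components `g_ij` of the metric in the chart around `x₀`, as functions of the
coordinates. -/
def gram (g : Metric n M) (x₀ : M) (y : Coord n) : Coord n →L[ℝ] Coord n →L[ℝ] ℝ :=
  bilComponents x₀ (g.inner ((extChartAt (𝓡 n) x₀).symm y))

/-- Christoffel symbols of the first kind, as a trilinear map:
`(u, v, w) ↦ ½ (∂_u g(v, w) + ∂_v g(u, w) - ∂_w g(u, v))`. -/
def christoffelLower (g : Metric n M) (x₀ : M) (y : Coord n) :
    Coord n →L[ℝ] Coord n →L[ℝ] Coord n →L[ℝ] ℝ :=
  let dG : Coord n →L[ℝ] Coord n →L[ℝ] Coord n →L[ℝ] ℝ := fderiv ℝ (gram g x₀) y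
  let dG₂ : Coord n →L[ℝ] Coord n →L[ℝ] Coord n →L[ℝ] ℝ := dG.flip
  let dG₃ : Coord n →L[ℝ] Coord n →L[ℝ] Coord n →L[ℝ] ℝ :=
    (ContinuousLinearMap.flipₗᵢ ℝ (Coord n) (Coord n) ℝ).toContinuousLinearEquiv
      |>.toContinuousLinearMap.comp dG₂
  (1 / 2 : ℝ) • (dG + dG₂ - dG₃)

/-- The Christoffel symbols `Γ(u, v)^k = Γ^k_ij u^i v^j` of the Levi-Civita connection of `g` in
the chart around `x₀`. -/
def christoffel (g : Metric n M) (x₀ : M) (y : Coord n) :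
    Coord n →L[ℝ] Coord n →L[ℝ] Coord n :=
  (ContinuousLinearMap.compL ℝ (Coord n) (Coord n →L[ℝ] ℝ) (Coord n)
    (gram g x₀ y).inverse).comp (christoffelLower g x₀ y)

/-- The components of the linear map `u ↦ R(u, v) w`, where
`R(u, v) w = ∇_u ∇_v w - ∇_v ∇_u w - ∇_[u,v] w` is the Riemann curvature of `g`. -/
def curvatureMap (g : Metric n M) (x₀ : M) (y v w : Coord n) : Coord n →L[ℝ] Coord n :=
  let Γ := christoffel g x₀ y
  let dΓ : Coord n →L[ℝ] Coord n →L[ℝ] Coord n →L[ℝ] Coord n := fderiv ℝ (christoffel g x₀) y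
  (dΓ.flip v).flip w - (dΓ v).flip w + Γ.flip (Γ v w) - (Γ v).comp (Γ.flip w)

/-- The components of the Ricci tensor: `Ric(v, w)` is the trace of `u ↦ R(u, v) w`. -/
def ricciComponents (g : Metric n M) (x₀ : M) (y : Coord n) :
    Coord n →L[ℝ] Coord n →L[ℝ] ℝ :=
  (LinearMap.mk₂ ℝ
    (fun v w => LinearMap.trace ℝ (Coord n) (curvatureMap g x₀ y v w).toLinearMap)
    (fun v v' w => by
      rw [← map_add]; congr 1; ext u : 1
      simp [curvatureMap]; abel)
    (fun c v w => by
      rw [← map_smul]; congr 1; ext u : 1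
      simp [curvatureMap, smul_sub, smul_add])
    (fun v w w' => by
      rw [← map_add]; congr 1; ext u : 1
      simp [curvatureMap]; abel)
    (fun c v w => by
      rw [← map_smul]; congr 1; ext u : 1
      simp [curvatureMap, smul_sub, smul_add])).toContinuousBilinearMap

/-- The Ricci tensor `R_ab` at `x`. -/
def ricci (g : Metric n M) (x : M) : Bil (n := n) x :=
  bilOfComponents x x (ricciComponents g x (extChartAt (𝓡 n) x x))

/-- The scalar curvature `R = g^{ab} R_ab` at `x`. -/
def scalarCurvature (g : Metric n M) (x : M) : ℝ :=
  ∑ i : Fin n, ricci g x (frame x x (EuclideanSpace.single i 1))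
    (sharp g (covOfComponents x x (EuclideanSpace.proj i)))

/-- The Schouten tensor `P_ab = (R_ab - R g_ab / (2 (n - 1))) / (n - 2)`, meaningful for `n ≥ 3`. -/
def schouten (g : Metric n M) (x : M) : Bil (n := n) x :=
  (1 / ((n : ℝ) - 2)) •
    (ricci g x - (scalarCurvature g x / (2 * ((n : ℝ) - 1))) • g.inner x)

/-- The covariant derivative `∇_a α_b` of a one-form, for the Levi-Civita connection of `g`. -/
def nablaOneForm (g : Metric n M) (α : ∀ x : M, Cov (n := n) x) (x : M) : Bil (n := n) x :=
  let y := extChartAt (𝓡 n) x x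
  let αc : Coord n → (Coord n →L[ℝ] ℝ) :=
    fun z => covComponents x (α ((extChartAt (𝓡 n) x).symm z))
  bilOfComponents x x (fderiv ℝ αc y -
    (ContinuousLinearMap.compL ℝ (Coord n) (Coord n) ℝ (αc y)).comp (christoffel g x y))

end Coordinates

/-! ### Conformal and Möbius structures -/

section Conformal

variable {n : ℕ} {M : Type*} [TopologicalSpace M] [ChartedSpace (Coord n) M]
  [IsManifold (𝓡 n) ∞ M]

/-- `ĝ = Ω² g` for the smooth positive function `Ω`. -/
structure IsConformalFactor (g g' : Metric n M) (Ω : M → ℝ) : Prop where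
  smooth : ContMDiff (𝓡 n) 𝓘(ℝ, ℝ) ∞ Ω
  pos : ∀ x, 0 < Ω x
  eq : ∀ (x : M) (v w : Tan (n := n) x), g'.inner x v w = Ω x ^ 2 * g.inner x v w

/-- The one-form `Υ_a = Ω⁻¹ ∇_a Ω`. -/
def upsilon (Ω : M → ℝ) (x : M) : Cov (n := n) x :=
  (Ω x)⁻¹ • (mfderiv (𝓡 n) 𝓘(ℝ, ℝ) Ω x : Tan (n := n) x →L[ℝ] ℝ)

variable (n M) in
/-- A conformal structure together with its tensors `P_ab`, one for every metric in the conformal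
class. In dimension `n ≥ 3` this is exactly a conformal class, since `P_ab` is the Schouten
tensor. In dimension `2` it is a Möbius structure: `P_ab` is part of the structure, and only
its transformation law under a change of metric is prescribed. -/
structure Structure where
  /-- The conformal class. -/
  metrics : Set (Metric n M)
  nonempty : metrics.Nonempty
  mem_iff : ∀ g ∈ metrics, ∀ g' : Metric n M, g' ∈ metrics ↔ ∃ Ω, IsConformalFactor g g' Ω
  /-- The tensor `P_ab` of a metric in the class. -/
  rho : metrics → ∀ x : M, Bil (n := n) x
  rho_eq_schouten : 3 ≤ n → ∀ (g : metrics) (x : M), rho g x = schouten g.1 x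
  rho_smooth : n = 2 → ∀ g : metrics,
    ContMDiff (𝓡 n) ((𝓡 n).prod 𝓘(ℝ, Coord n →L[ℝ] Coord n →L[ℝ] ℝ)) ∞
      (fun x : M => Bundle.TotalSpace.mk' (Coord n →L[ℝ] Coord n →L[ℝ] ℝ)
        (E := fun x : M => TangentSpace (𝓡 n) x →L[ℝ] TangentSpace (𝓡 n) x →L[ℝ] ℝ) x (rho g x))
  rho_symm : n = 2 → ∀ (g : metrics) (x : M) (u v : Tan (n := n) x), rho g x u v = rho g x v u
  rho_transform : n = 2 → ∀ (g g' : metrics) (Ω : M → ℝ), IsConformalFactor g.1 g'.1 Ω →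
    ∀ x : M, rho g' x = rho g x - nablaOneForm g.1 (upsilon Ω) x
      + (upsilon Ω x).smulRight (upsilon Ω x)
      - ((1 / 2 : ℝ) * coInner g.1 (upsilon Ω x) (upsilon Ω x)) • g.1.inner x

end Conformal

/-! ### Adjoint tractors -/

section Tractors

variable {n : ℕ} {M : Type*} [TopologicalSpace M] [ChartedSpace (Coord n) M]

/-- The slots `(σ_b, μ_bc, ν, ρ_b)` of an adjoint tractor at `x` in the presence of a metric, all
indices lowered and all weights trivialised with this metric. -/
abbrev Slots (x : M) : Type :=
  Cov (n := n) x × Bil (n := n) x × ℝ × Cov (n := n) x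

variable [IsManifold (𝓡 n) ∞ M]

/-- The slots with respect to `Ω² g` of the adjoint tractor that has the slots `t` with respect
to `g`. The slots `σ_b` and `μ_bc` have conformal weight `2`, the others have weight `0`. -/
def rescale (g : Metric n M) (Ω : M → ℝ) (x : M) (t : Slots (n := n) x) : Slots (n := n) x :=
  let Υ := upsilon (n := n) Ω x
  let σ := t.1
  let μ := t.2.1
  let ν := t.2.2.1
  let ρ := t.2.2.2
  ((Ω x ^ 2) • σ,
   (Ω x ^ 2) • (μ + wedge Υ σ),
   ν + coInner g σ Υ,
   ρ + μ (sharp g Υ) - ν • Υ - (coInner g σ Υ) • Υ + ((1 / 2 : ℝ) * coInner g Υ Υ) • σ)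

theorem rescale_add (g : Metric n M) (Ω : M → ℝ) (x : M) (t t' : Slots (n := n) x) :
    rescale g Ω x (t + t') = rescale g Ω x t + rescale g Ω x t' := by
  refine Prod.ext ?_ (Prod.ext ?_ (Prod.ext ?_ ?_))
  · simp [rescale]
  · ext u v
    simp [rescale, wedge]; ring
  · simp [rescale, coInner]; ring
  · ext u
    simp [rescale, coInner]; ring

theorem rescale_smul (g : Metric n M) (Ω : M → ℝ) (x : M) (r : ℝ) (t : Slots (n := n) x) :
    rescale g Ω x (r • t) = r • rescale g Ω x t := by
  refine Prod.ext ?_ (Prod.ext ?_ (Prod.ext ?_ ?_))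
  · exact smul_comm _ _ _
  · ext u v
    simp [rescale, wedge]; ring
  · simp [rescale, coInner]; ring
  · ext u
    simp [rescale, coInner]; ring

/-- The fibre at `x` of the adjoint tractor bundle: its elements are given by slots in the presence
of each metric in the conformal class (`μ_bc` being skew), which are related by the transformation
law whenever the metric is rescaled. -/
def adjointTractor (c : Structure n M) (x : M) :
    Submodule ℝ (c.metrics → Slots (n := n) x) where
  carrier := {Φ | (∀ (g : c.metrics) (u : Tan (n := n) x), (Φ g).2.1 u u = 0) ∧
    ∀ (g g' : c.metrics) (Ω : M → ℝ), IsConformalFactor g.1 g'.1 Ω →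
      Φ g' = rescale g.1 Ω x (Φ g)}
  add_mem' := by
    rintro Φ Ψ ⟨h1, h2⟩ ⟨k1, k2⟩
    refine ⟨fun g u => by simp [h1, k1], fun g g' Ω h => ?_⟩
    simp only [Pi.add_apply]
    rw [h2 g g' Ω h, k2 g g' Ω h, rescale_add]
  zero_mem' := by
    refine ⟨fun g u => by simp, fun g g' Ω h => ?_⟩
    have h0 := rescale_add g.1 Ω x (0 : Slots (n := n) x) 0
    rw [add_zero] at h0
    exact (left_eq_add.mp h0).symm
  smul_mem' := by
    rintro r Φ ⟨h1, h2⟩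
    refine ⟨fun g u => by simp [h1], fun g g' Ω h => ?_⟩
    simp only [Pi.smul_apply]
    rw [h2 g g' Ω h, rescale_smul]

end Tractors

/-! ### Curves -/

section Curves

variable {n : ℕ} {M : Type*} [TopologicalSpace M] [ChartedSpace (Coord n) M]

/-- The velocity of a parametrised curve. -/
def velocity (γ : ℝ → M) (s : ℝ) : Tan (n := n) (γ s) :=
  mfderiv 𝓘(ℝ, ℝ) (𝓡 n) γ s (1 : ℝ)

variable (n) in
/-- A smooth oriented curve: it is given by a smooth regular parametrisation, compatible with the
orientation, by a non-empty open interval. -/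
structure IsOrientedCurve (γ : ℝ → M) (I : Set ℝ) : Prop where
  isOpen : IsOpen I
  ordConnected : I.OrdConnected
  nonempty : I.Nonempty
  smooth : ContMDiffOn 𝓘(ℝ, ℝ) (𝓡 n) ∞ γ I
  regular : ∀ s ∈ I, velocity (n := n) γ s ≠ 0

variable [IsManifold (𝓡 n) ∞ M]

/-- The speed of a parametrised curve with respect to `g`. -/
def speed (g : Metric n M) (γ : ℝ → M) (s : ℝ) : ℝ :=
  Real.sqrt (g.inner (γ s) (velocity γ s) (velocity γ s))

/-- The unit tangent vector `U^a` along the curve. -/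
def unitTangent (g : Metric n M) (γ : ℝ → M) (s : ℝ) : Tan (n := n) (γ s) :=
  (speed g γ s)⁻¹ • velocity γ s

/-- The directional derivative `∂ = U^a ∇_a` on functions along the curve. -/
def delFun (g : Metric n M) (γ : ℝ → M) (f : ℝ → ℝ) (s : ℝ) : ℝ :=
  (speed g γ s)⁻¹ * deriv f s

/-- The endomorphism `Γ(U, ·)` at `γ s`, in the chart around `γ s`. -/
def connectionAlong (g : Metric n M) (γ : ℝ → M) (s : ℝ) : Coord n →L[ℝ] Coord n :=
  christoffel g (γ s) (extChartAt (𝓡 n) (γ s) (γ s))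
    (components (γ s) (γ s) (unitTangent g γ s))

/-- The directional derivative `∂ = U^a ∇_a` on covector fields along the curve, for the
Levi-Civita connection of `g`, computed at `γ s` in the chart around `γ s`. -/
def delCov (g : Metric n M) (γ : ℝ → M) (α : ∀ s, Cov (n := n) (γ s)) (s : ℝ) :
    Cov (n := n) (γ s) :=
  covOfComponents (γ s) (γ s)
    ((speed g γ s)⁻¹ • deriv (fun t => covComponents (γ s) (α t)) s
      - (covComponents (γ s) (α s)).comp (connectionAlong g γ s))

/-- The directional derivative `∂ = U^a ∇_a` on fields of bilinear forms along the curve, for the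
Levi-Civita connection of `g`, computed at `γ s` in the chart around `γ s`. -/
def delBil (g : Metric n M) (γ : ℝ → M) (B : ∀ s, Bil (n := n) (γ s)) (s : ℝ) :
    Bil (n := n) (γ s) :=
  bilOfComponents (γ s) (γ s)
    ((speed g γ s)⁻¹ • deriv (fun t => bilComponents (γ s) (B t)) s
      - (bilComponents (γ s) (B s)).comp (connectionAlong g γ s)
      - (ContinuousLinearMap.precomp ℝ (connectionAlong g γ s)).comp (bilComponents (γ s) (B s)))

/-- `U_a = g_ab U^b`. -/
def unitCotangent (g : Metric n M) (γ : ℝ → M) (s : ℝ) : Cov (n := n) (γ s) :=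
  g.inner (γ s) (unitTangent g γ s)

/-- The acceleration `A_a = ∂ U_a`. -/
def acceleration (g : Metric n M) (γ : ℝ → M) (s : ℝ) : Cov (n := n) (γ s) :=
  delCov g γ (unitCotangent g γ) s

/-- The covector `U^a P_ab`. -/
def rhoU (c : Structure n M) (g : c.metrics) (γ : ℝ → M) (s : ℝ) : Cov (n := n) (γ s) :=
  c.rho g (γ s) (unitTangent g.1 γ s)

/-- The normalised jerk `J_a = ∂ A_a + (A^b A_b + P_bc U^b U^c) U_a - P_ab U^b`, with respect to
the background metric `g`. -/
def normalisedJerk (c : Structure n M) (g : c.metrics) (γ : ℝ → M) (s : ℝ) :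
    Cov (n := n) (γ s) :=
  delCov g.1 γ (acceleration g.1 γ) s
    + (coInner g.1 (acceleration g.1 γ s) (acceleration g.1 γ s)
        + rhoU c g γ s (unitTangent g.1 γ s)) • unitCotangent g.1 γ s
    - rhoU c g γ s

/-- The curve is a conformal circle, that is `J_a ≡ 0`, with respect to the background
metric `g`. -/
def IsConformalCircle (c : Structure n M) (g : c.metrics) (γ : ℝ → M) (I : Set ℝ) : Prop :=
  ∀ s ∈ I, normalisedJerk c g γ s = 0

/-- The span at `γ s` of the three slot vectors `(0, 0, 0, U_b)`, `(0, 0, 1, A_b)` and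
`(U_b, 2 U_[b A_c], 0, 0)` with respect to the metric `g`. -/
def spanB (g : Metric n M) (γ : ℝ → M) (s : ℝ) : Submodule ℝ (Slots (n := n) (γ s)) :=
  Submodule.span ℝ
    {((0, 0, 0, unitCotangent g γ s) : Slots (n := n) (γ s)),
     (0, 0, 1, acceleration g γ s),
     (unitCotangent g γ s, wedge (unitCotangent g γ s) (acceleration g γ s), 0, 0)}

/-- The fibre at `γ s` of the subbundle `B` of the adjoint tractor bundle along `γ`: the
adjoint tractors whose slots lie in `spanB`, whichever metric in the conformal class is used. -/
def bundleB (c : Structure n M) (γ : ℝ → M) (s : ℝ) : Submodule ℝ (adjointTractor c (γ s)) :=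
  ⨅ g : c.metrics, (spanB g.1 γ s).comap
    ((LinearMap.proj g : (c.metrics → Slots (n := n) (γ s)) →ₗ[ℝ] Slots (n := n) (γ s)).comp
      (adjointTractor c (γ s)).subtype)

/-- Smoothness along the curve of a field of slots. -/
def SmoothSlots (γ : ℝ → M) (I : Set ℝ) (t : ∀ s, Slots (n := n) (γ s)) : Prop :=
  ∀ s ∈ I,
    ContDiffAt ℝ ∞ (fun r => covComponents (γ s) (t r).1) s ∧
    ContDiffAt ℝ ∞ (fun r => bilComponents (γ s) (t r).2.1) s ∧
    ContDiffAt ℝ ∞ (fun r => (t r).2.2.1) s ∧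
    ContDiffAt ℝ ∞ (fun r => covComponents (γ s) (t r).2.2.2) s

/-- Smooth sections along the curve of the adjoint tractor bundle. -/
def SmoothSection (c : Structure n M) (γ : ℝ → M) (I : Set ℝ)
    (Φ : ∀ s, adjointTractor c (γ s)) : Prop :=
  ∀ g : c.metrics, SmoothSlots γ I (fun s => (Φ s).1 g)

/-- The tractor directional derivative `∂ = U^a ∇_a` along the curve, written in the presence of
the metric `g`: the slots of `∂ Φ` in terms of the slots `t` of `Φ`. -/
def delSlots (c : Structure n M) (g : c.metrics) (γ : ℝ → M) (t : ∀ s, Slots (n := n) (γ s))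
    (s : ℝ) : Slots (n := n) (γ s) :=
  let U := unitTangent g.1 γ s
  let Uflat := unitCotangent g.1 γ s
  let p := rhoU c g γ s
  let σ := (t s).1
  let μ := (t s).2.1
  let ν := (t s).2.2.1
  let ρ := (t s).2.2.2
  (delCov g.1 γ (fun r => (t r).1) s - μ U - ν • Uflat,
   delBil g.1 γ (fun r => (t r).2.1) s - wedge Uflat ρ + wedge p σ,
   delFun g.1 γ (fun r => (t r).2.2.1) s + ρ U + p (sharp g.1 σ),
   delCov g.1 γ (fun r => (t r).2.2.2) s - contractSnd μ (sharp g.1 p) - ν • p)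

/-- The subbundle `B` is preserved by the tractor directional derivative `∂` along the curve,
computed in the presence of the metric `g`: for every smooth section `Φ` of `B`, the derivative
`∂ Φ` again takes values in `B`. (The derivative is a section of the adjoint tractor bundle twisted
by the densities of weight `-1`; here densities are trivialised with `g`, so that `∂ Φ` is at each
point of the curve the adjoint tractor `Ψ` whose slots with respect to `g` are given by
`delSlots`.) -/
def PreservesB (c : Structure n M) (g : c.metrics) (γ : ℝ → M) (I : Set ℝ) : Prop :=
  ∀ Φ : (∀ s, adjointTractor c (γ s)), SmoothSection c γ I Φ → (∀ s ∈ I, Φ s ∈ bundleB c γ s) →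
    ∀ s ∈ I, ∃ Ψ : adjointTractor c (γ s),
      Ψ.1 g = delSlots c g γ (fun r => (Φ r).1 g) s ∧ Ψ ∈ bundleB c γ s

end Curves

end ConformalCircles

end

/-! Fix a metric g of the class. A section of B has slots (m U, m U∧A, l, k U + l A), with functions
k, l, m along the curve. Differentiate these with the tractor formula, use ∂U = A, and solve the
definition of J for ∂A. The result is again of this form, up to the error terms m U∧J in the second
slot and l J in the fourth (`IsOrientedCurve.delSlots_eq`). So J = 0 implies that B is preserved.
Conversely, the derivative of the section (0, 0, 1, A) lies in B only if J is a multiple of U. Since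
U·A = 0 gives U·∂A = -A·A, the jerk satisfies U·J = 0
(`IsOrientedCurve.normalisedJerk_unitTangent`), and therefore J = 0.

B is defined by a condition on the slots in every metric. It can be tested in one metric, because
the span is carried to the corresponding span by conformal rescaling
(`IsOrientedCurve.rescale_mem_spanB`). This rests on the law Â = A - Υ + Υ(U) U
(`IsOrientedCurve.acceleration_conformal`). Conversely, slots in one metric with μ skew extend to an
adjoint tractor by the cocycle property `rescale_mul`, so each fibre of B is isomorphic to a span of
three independent vectors.

The analytic difficulty is that ∂ at a point is computed in the chart around that same point, so A
is defined in a chart that moves along the curve, yet A has to be differentiated again. The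
Lagrangian form of A, `accelerationComponents`, makes sense in any chart and transforms as a
covector. This gives smooth components of A in a fixed chart. -/

noncomputable section

namespace ConformalCircles

/-! ### Pointwise algebra: raising indices, conformal factors, adjoint tractors from slots. -/

section PointwiseAlgebra

variable {n : ℕ} {M : Type*} [TopologicalSpace M] [ChartedSpace (Coord n) M]

/-- A positive bilinear form on a finite-dimensional space identifies the space with its dual. -/
theorem isInvertible_of_pos {E : Type*} [NormedAddCommGroup E] [NormedSpace ℝ E]
    [FiniteDimensional ℝ E] (B : E →L[ℝ] E →L[ℝ] ℝ) (h : ∀ v, v ≠ 0 → 0 < B v v) :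
    B.IsInvertible := by
  have hinj : Function.Injective B.toLinearMap := by
    rw [← LinearMap.ker_eq_bot, LinearMap.ker_eq_bot']
    intro v hv
    by_contra hne
    have h1 := h v hne
    have h2 : B v = 0 := hv
    simp [h2] at h1
  have hfr : Module.finrank ℝ E = Module.finrank ℝ (E →L[ℝ] ℝ) := by
    rw [← (LinearMap.toContinuousLinearMap (E := E) (F' := ℝ) (𝕜 := ℝ)).finrank_eq]
    exact (Subspace.dual_finrank_eq).symm
  exact ⟨(LinearEquiv.ofInjectiveOfFinrankEq B.toLinearMap hinj hfr).toContinuousLinearEquiv, by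
    ext v w; rfl⟩

@[simp] theorem wedge_apply {x : M} (α β : Cov (n := n) x) (u v : Tan (n := n) x) :
    wedge α β u v = α u * β v - β u * α v := by
  simp [wedge]

@[simp] theorem contractSnd_apply {x : M} (B : Bil (n := n) x) (u v : Tan (n := n) x) :
    contractSnd B v u = B u v := rfl

theorem wedge_self {x : M} (α : Cov (n := n) x) : wedge α α = 0 := by
  simp [wedge]

/-- The differential of a function, as a covector. -/
def differential (f : M → ℝ) (x : M) : Cov (n := n) x := mfderiv (𝓡 n) 𝓘(ℝ, ℝ) f x

theorem upsilon_eq (Ω : M → ℝ) (x : M) :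
    upsilon (n := n) Ω x = (Ω x)⁻¹ • differential (n := n) Ω x := rfl

theorem wedge_zero {x : M} (α : Cov (n := n) x) : wedge α 0 = 0 := by
  ext u v
  simp

@[simp] theorem upsilon_one (x : M) : upsilon (n := n) (fun _ : M => (1 : ℝ)) x = 0 := by
  have h : differential (n := n) (fun _ : M => (1 : ℝ)) x = 0 := mfderiv_const
  rw [upsilon_eq, h, smul_zero]

/-- Υ is the logarithmic differential of Ω, hence additive on products. -/
theorem upsilon_mul {Ω Ω' : M → ℝ} {x : M} (h : MDifferentiableAt (𝓡 n) 𝓘(ℝ, ℝ) Ω x)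
    (h' : MDifferentiableAt (𝓡 n) 𝓘(ℝ, ℝ) Ω' x) (h0 : Ω x ≠ 0) (h0' : Ω' x ≠ 0) :
    upsilon (n := n) (fun x => Ω x * Ω' x) x = upsilon (n := n) Ω x + upsilon (n := n) Ω' x := by
  have key : differential (n := n) (fun x => Ω x * Ω' x) x
      = Ω x • differential (n := n) Ω' x + Ω' x • differential (n := n) Ω x :=
    (h.hasMFDerivAt.mul h'.hasMFDerivAt).mfderiv
  rw [upsilon_eq, upsilon_eq, upsilon_eq, key, smul_add, smul_smul, smul_smul, add_comm]
  congr 2 <;> field_simp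

variable [IsManifold (𝓡 n) ∞ M]

theorem isInvertible_inner (g : Metric n M) (x : M) : (g.inner x).IsInvertible :=
  isInvertible_of_pos (E := Coord n) (g.inner x) (g.pos x)

@[simp] theorem inner_sharp (g : Metric n M) {x : M} (α : Cov (n := n) x) :
    g.inner x (sharp g α) = α :=
  (isInvertible_inner g x).self_apply_inverse α

@[simp] theorem sharp_inner (g : Metric n M) {x : M} (v : Tan (n := n) x) :
    sharp g (g.inner x v) = v :=
  (isInvertible_inner g x).inverse_apply_self v

theorem sharp_eq_iff (g : Metric n M) {x : M} {α : Cov (n := n) x} {v : Tan (n := n) x} :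
    sharp g α = v ↔ g.inner x v = α := by
  constructor
  · rintro rfl; simp
  · rintro rfl; simp

theorem sharp_add (g : Metric n M) {x : M} (α β : Cov (n := n) x) :
    sharp g (α + β) = sharp g α + sharp g β := map_add _ _ _

theorem sharp_smul (g : Metric n M) {x : M} (r : ℝ) (α : Cov (n := n) x) :
    sharp g (r • α) = r • sharp g α := map_smul _ _ _

theorem coInner_comm (g : Metric n M) {x : M} (α β : Cov (n := n) x) :
    coInner g α β = coInner g β α := by
  unfold coInner
  conv_lhs => rw [← inner_sharp g α]
  conv_rhs => rw [← inner_sharp g β]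
  exact g.symm _ _ _

theorem inner_apply_sharp (g : Metric n M) {x : M} (α : Cov (n := n) x) (v : Tan (n := n) x) :
    g.inner x v (sharp g α) = α v := by
  rw [g.symm, inner_sharp]

/-! ### Uniqueness of conformal factors and the cocycle property of the rescaling of slots -/

/-- Evaluation on a nonzero vector gives Ω² = Ω'², and both factors are positive. This makes
`ofSlots` independent of the chosen factors. -/
theorem IsConformalFactor.unique [NeZero n] {g g' : Metric n M} {Ω Ω' : M → ℝ}
    (h : IsConformalFactor g g' Ω) (h' : IsConformalFactor g g' Ω') : Ω = Ω' := by
  funext x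
  obtain ⟨v, hv⟩ : ∃ v : Coord n, v ≠ 0 := exists_ne 0
  have h1 := h.eq x v v
  rw [h'.eq x v v] at h1
  have h2 := mul_right_cancel₀ (g.pos x v hv).ne' h1
  exact ((pow_left_inj₀ (h'.pos x).le (h.pos x).le two_ne_zero).mp h2).symm

theorem isConformalFactor_one (g : Metric n M) : IsConformalFactor g g (fun _ => 1) :=
  ⟨contMDiff_const, fun _ => one_pos, fun x v w => by simp⟩

theorem IsConformalFactor.mul {g g' g'' : Metric n M} {Ω Ω' : M → ℝ}
    (h : IsConformalFactor g g' Ω) (h' : IsConformalFactor g' g'' Ω') :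
    IsConformalFactor g g'' (fun x => Ω x * Ω' x) :=
  ⟨h.smooth.mul h'.smooth, fun x => mul_pos (h.pos x) (h'.pos x), fun x v w => by
    rw [h'.eq, h.eq]; ring⟩

theorem IsConformalFactor.inner_eq {g g' : Metric n M} {Ω : M → ℝ}
    (h : IsConformalFactor g g' Ω) {x : M} (v : Tan (n := n) x) :
    g'.inner x v = Ω x ^ 2 • g.inner x v := by
  ext w
  exact h.eq x v w

theorem IsConformalFactor.sharp_eq {g g' : Metric n M} {Ω : M → ℝ}
    (h : IsConformalFactor g g' Ω) {x : M} (α : Cov (n := n) x) :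
    sharp g' α = (Ω x ^ 2)⁻¹ • sharp g α := by
  have h0 : Ω x ^ 2 ≠ 0 := pow_ne_zero _ (h.pos x).ne'
  rw [sharp_eq_iff, h.inner_eq, map_smul, inner_sharp, smul_smul, mul_inv_cancel₀ h0, one_smul]

theorem rescale_one (g : Metric n M) (x : M) (t : Slots (n := n) x) :
    rescale g (fun _ => 1) x t = t := by
  have h0 : sharp g (0 : Cov (n := n) x) = 0 := map_zero _
  refine Prod.ext ?_ (Prod.ext ?_ (Prod.ext ?_ ?_))
  · simp [rescale]
  · ext u v
    simp [rescale]
  · simp [rescale, coInner, h0]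
  · simp [rescale, coInner, h0]

/-- Υ is additive in the factor, and raising an index with g' instead of g divides by Ω². This is
the compatibility that lets slots in one metric define an adjoint tractor. -/
theorem rescale_mul {g g' : Metric n M} {Ω Ω' : M → ℝ} (h : IsConformalFactor g g' Ω)
    (h' : ContMDiff (𝓡 n) 𝓘(ℝ, ℝ) ∞ Ω') (h0' : ∀ x, 0 < Ω' x) (x : M) (t : Slots (n := n) x) :
    rescale g (fun x => Ω x * Ω' x) x t = rescale g' Ω' x (rescale g Ω x t) := by
  have hΩ : Ω x ≠ 0 := (h.pos x).ne'
  have hΥ := upsilon_mul (x := x) (h.smooth.mdifferentiableAt (by simp))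
    (h'.mdifferentiableAt (by simp)) hΩ (h0' x).ne'
  -- The expansion of |Υ + Υ'|² has two cross terms, which this symmetry identifies in the last
  -- slot.
  have hc := coInner_comm g (upsilon (n := n) Ω x) (upsilon (n := n) Ω' x)
  unfold coInner at hc
  refine Prod.ext ?_ (Prod.ext ?_ (Prod.ext ?_ ?_))
  · simp only [rescale]
    rw [smul_smul]; congr 1; ring
  · ext u v
    simp only [rescale, hΥ]
    simp
    ring
  · simp only [rescale, hΥ, coInner, h.sharp_eq, sharp_add]
    simp
    field_simp
    ring
  · ext u
    simp only [rescale, hΥ, coInner, h.sharp_eq, sharp_add]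
    simp
    rw [hc]
    field_simp
    ring

theorem rescale_skew (g : Metric n M) (Ω : M → ℝ) (x : M) (t : Slots (n := n) x)
    (ht : ∀ u, t.2.1 u u = 0) (u : Tan (n := n) x) : (rescale g Ω x t).2.1 u u = 0 := by
  simp [rescale, ht]
  right; ring

/-- An adjoint tractor is determined by its slots with respect to one metric. -/
theorem adjointTractor_ext {c : Structure n M} {x : M} (g : c.metrics) {Φ Ψ : adjointTractor c x}
    (h : Φ.1 g = Ψ.1 g) : Φ = Ψ := by
  apply Subtype.ext
  funext g'
  obtain ⟨Ω, hΩ⟩ := (c.mem_iff g.1 g.2 g'.1).mp g'.2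
  rw [Φ.2.2 g g' Ω hΩ, Ψ.2.2 g g' Ω hΩ, h]

/-- The conformal factor relating two metrics of a conformal class. -/
def conformalFactor (c : Structure n M) (g g' : c.metrics) : M → ℝ :=
  ((c.mem_iff g.1 g.2 g'.1).mp g'.2).choose

theorem conformalFactor_spec (c : Structure n M) (g g' : c.metrics) :
    IsConformalFactor g.1 g'.1 (conformalFactor c g g') :=
  ((c.mem_iff g.1 g.2 g'.1).mp g'.2).choose_spec

/-- The adjoint tractor with the given slots with respect to the metric `g`. -/
def ofSlots [NeZero n] (c : Structure n M) (g : c.metrics) (x : M) (t : Slots (n := n) x)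
    (ht : ∀ u, t.2.1 u u = 0) : adjointTractor c x :=
  ⟨fun g' => rescale g.1 (conformalFactor c g g') x t, fun g' u => rescale_skew _ _ _ _ ht u, by
    intro g₁ g₂ Ω hΩ
    -- The factors from g to g₁ and from g to g₂ are chosen independently. Uniqueness identifies the
    -- second with the first times Ω.
    have h := (conformalFactor_spec c g g₁).mul hΩ
    beta_reduce
    rw [(conformalFactor_spec c g g₂).unique h]
    exact rescale_mul (conformalFactor_spec c g g₁) hΩ.smooth hΩ.pos x t⟩

theorem ofSlots_apply [NeZero n] (c : Structure n M) (g g' : c.metrics) (x : M)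
    (t : Slots (n := n) x) (ht : ∀ u, t.2.1 u u = 0) {Ω : M → ℝ}
    (hΩ : IsConformalFactor g.1 g'.1 Ω) : (ofSlots c g x t ht).1 g' = rescale g.1 Ω x t := by
  rw [hΩ.unique (conformalFactor_spec c g g')]
  rfl

theorem ofSlots_self [NeZero n] (c : Structure n M) (g : c.metrics) (x : M)
    (t : Slots (n := n) x) (ht : ∀ u, t.2.1 u u = 0) : (ofSlots c g x t ht).1 g = t := by
  rw [ofSlots_apply c g g x t ht (isConformalFactor_one g.1), rescale_one]

end PointwiseAlgebra

/-! ### Charts: frames, transition maps, smoothness of the metric components. -/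

section Charts

variable {n : ℕ} {M : Type*} [TopologicalSpace M] [ChartedSpace (Coord n) M]

theorem hasDerivAt_comp_curve {γ : ℝ → M} {r : ℝ} {f : M → ℝ}
    (hγ : MDifferentiableAt 𝓘(ℝ, ℝ) (𝓡 n) γ r) (hf : MDifferentiableAt (𝓡 n) 𝓘(ℝ, ℝ) f (γ r)) :
    HasDerivAt (fun t => f (γ t)) (differential (n := n) f (γ r) (velocity γ r)) r := by
  have h := hf.hasMFDerivAt.comp r hγ.hasMFDerivAt
  have h' : HasFDerivAt (fun t => f (γ t))
      (show ℝ →L[ℝ] ℝ from (differential (n := n) f (γ r)).comp (mfderiv 𝓘(ℝ, ℝ) (𝓡 n) γ r)) r :=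
    h.hasFDerivAt
  exact h'.hasDerivAt

theorem eventually_mem_target {x₀ x : M} (hx : x ∈ (chartAt (Coord n) x₀).source) :
    ∀ᶠ y in 𝓝 (extChartAt (𝓡 n) x₀ x), y ∈ (extChartAt (𝓡 n) x₀).target :=
  extChartAt_target_mem_nhds' (by
    exact (extChartAt (𝓡 n) x₀).map_source (by simpa using hx))

variable [IsManifold (𝓡 n) ∞ M]

theorem frame_components {x₀ x : M} (hx : x ∈ (chartAt (Coord n) x₀).source)
    (v : Tan (n := n) x) : frame x₀ x (components x₀ x v) = v :=
  Bundle.Trivialization.symmL_continuousLinearMapAt _ (by simpa using hx) v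

theorem components_frame {x₀ x : M} (hx : x ∈ (chartAt (Coord n) x₀).source)
    (v : Coord n) : components x₀ x (frame x₀ x v) = v :=
  Bundle.Trivialization.continuousLinearMapAt_symmL _ (by simpa using hx) v

theorem hasMFDerivAt_extChartAt_components {x₀ x : M}
    (hx : x ∈ (chartAt (Coord n) x₀).source) :
    HasMFDerivAt (𝓡 n) 𝓘(ℝ, Coord n) (extChartAt (𝓡 n) x₀) x (components x₀ x) := by
  have : IsManifold (𝓡 n) 1 M := .of_le (n := ∞) (by simp)
  have h := (mdifferentiableAt_extChartAt (I := 𝓡 n) hx).hasMFDerivAt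
  rw [← TangentBundle.continuousLinearMapAt_trivializationAt (𝕜 := ℝ) hx] at h
  exact h

/-- The `show` places `frame x₀ x` in the fibre at the image of the image of x, a point equal to x
only propositionally. Users of the lemma rewrite with `left_inv` for the same reason. -/
theorem hasMFDerivAt_extChartAt_symm_frame {x₀ x : M}
    (hx : x ∈ (chartAt (Coord n) x₀).source) :
    HasMFDerivAt 𝓘(ℝ, Coord n) (𝓡 n) (extChartAt (𝓡 n) x₀).symm (extChartAt (𝓡 n) x₀ x)
      (show Coord n →L[ℝ] TangentSpace (𝓡 n) ((extChartAt (𝓡 n) x₀).symm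
        (extChartAt (𝓡 n) x₀ x)) from frame x₀ x) := by
  have : IsManifold (𝓡 n) 1 M := .of_le (n := ∞) (by simp)
  have ht : extChartAt (𝓡 n) x₀ x ∈ (extChartAt (𝓡 n) x₀).target :=
    (extChartAt (𝓡 n) x₀).map_source (by simpa using hx)
  have h := (mdifferentiableWithinAt_extChartAt_symm (I := 𝓡 n) ht).hasMFDerivWithinAt
  rw [← TangentBundle.symmL_trivializationAt (𝕜 := ℝ) hx] at h
  have h' := h.hasMFDerivAt (by simp)
  exact h'

theorem hasDerivAt_extChartAt_comp {γ : ℝ → M} {r : ℝ} {x₀ : M}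
    (hγ : MDifferentiableAt 𝓘(ℝ, ℝ) (𝓡 n) γ r) (hx : γ r ∈ (chartAt (Coord n) x₀).source) :
    HasDerivAt (fun t => extChartAt (𝓡 n) x₀ (γ t))
      (components x₀ (γ r) (velocity γ r)) r := by
  have h := (hasMFDerivAt_extChartAt_components hx).comp r hγ.hasMFDerivAt
  have h' : HasFDerivAt (fun t => extChartAt (𝓡 n) x₀ (γ t))
      (show ℝ →L[ℝ] Coord n from (components x₀ (γ r)).comp (mfderiv 𝓘(ℝ, ℝ) (𝓡 n) γ r)) r :=
    h.hasFDerivAt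
  exact h'.hasDerivAt

theorem hasFDerivAt_comp_extChartAt_symm {f : M → ℝ} {x₀ x : M}
    (hx : x ∈ (chartAt (Coord n) x₀).source) (hf : MDifferentiableAt (𝓡 n) 𝓘(ℝ, ℝ) f x) :
    HasFDerivAt (fun y => f ((extChartAt (𝓡 n) x₀).symm y))
      (covComponents x₀ (differential (n := n) f x)) (extChartAt (𝓡 n) x₀ x) := by
  have hinv : (extChartAt (𝓡 n) x₀).symm (extChartAt (𝓡 n) x₀ x) = x :=
    (extChartAt (𝓡 n) x₀).left_inv (by simpa using hx)
  have hf' := hf.hasMFDerivAt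
  have h : HasMFDerivAt 𝓘(ℝ, Coord n) 𝓘(ℝ, ℝ) (f ∘ (extChartAt (𝓡 n) x₀).symm)
      (extChartAt (𝓡 n) x₀ x) (covComponents x₀ (differential (n := n) f x)) := by
    refine HasMFDerivAt.comp (g' := differential (n := n) f x) (I' := 𝓡 n) _ ?_
      (hasMFDerivAt_extChartAt_symm_frame hx)
    rw [hinv]
    exact hf'
  exact h.hasFDerivAt

/-- The transition map from the chart around `x₀` to the chart around `x₁`. -/
def transition (x₀ x₁ : M) (y : Coord n) : Coord n :=
  extChartAt (𝓡 n) x₁ ((extChartAt (𝓡 n) x₀).symm y)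

theorem hasFDerivAt_transition {x₀ x₁ x : M} (hx : x ∈ (chartAt (Coord n) x₀).source)
    (hx₁ : x ∈ (chartAt (Coord n) x₁).source) :
    HasFDerivAt (transition x₀ x₁) ((components x₁ x).comp (frame x₀ x))
      (extChartAt (𝓡 n) x₀ x) := by
  have hinv : (extChartAt (𝓡 n) x₀).symm (extChartAt (𝓡 n) x₀ x) = x :=
    (extChartAt (𝓡 n) x₀).left_inv (by simpa using hx)
  have h : HasMFDerivAt 𝓘(ℝ, Coord n) 𝓘(ℝ, Coord n)
      (extChartAt (𝓡 n) x₁ ∘ (extChartAt (𝓡 n) x₀).symm)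
      (extChartAt (𝓡 n) x₀ x) ((components x₁ x).comp (frame x₀ x)) := by
    refine HasMFDerivAt.comp (g' := components x₁ x) (I' := 𝓡 n) _ ?_
      (hasMFDerivAt_extChartAt_symm_frame hx)
    rw [hinv]
    exact hasMFDerivAt_extChartAt_components hx₁
  exact h.hasFDerivAt

theorem contDiffAt_transition {x₀ x₁ x : M} (hx : x ∈ (chartAt (Coord n) x₀).source)
    (hx₁ : x ∈ (chartAt (Coord n) x₁).source) :
    ContDiffAt ℝ ∞ (transition x₀ x₁) (extChartAt (𝓡 n) x₀ x) := by
  have hinv : (extChartAt (𝓡 n) x₀).symm (extChartAt (𝓡 n) x₀ x) = x :=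
    (extChartAt (𝓡 n) x₀).left_inv (by simpa using hx)
  rw [← contMDiffAt_iff_contDiffAt]
  refine ContMDiffAt.comp (I' := 𝓡 n) _ ?_
    ((contMDiffOn_extChartAt_symm x₀).contMDiffAt (eventually_mem_target hx))
  rw [hinv]
  exact contMDiffAt_extChartAt' hx₁

theorem bilComponents_apply (x₀ : M) {x : M} (B : Bil (n := n) x) (u v : Coord n) :
    bilComponents x₀ B u v = B (frame x₀ x u) (frame x₀ x v) := rfl

theorem covComponents_apply (x₀ : M) {x : M} (α : Cov (n := n) x) (u : Coord n) :
    covComponents x₀ α u = α (frame x₀ x u) := rfl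

theorem gram_apply (g : Metric n M) (x₀ : M) (y u v : Coord n) :
    gram g x₀ y u v = g.inner ((extChartAt (𝓡 n) x₀).symm y)
      (frame x₀ _ u) (frame x₀ _ v) := rfl

theorem gram_extChartAt (g : Metric n M) {x₀ x : M} (hx : x ∈ (chartAt (Coord n) x₀).source) :
    gram g x₀ (extChartAt (𝓡 n) x₀ x) = bilComponents x₀ (g.inner x) := by
  have hinv : (extChartAt (𝓡 n) x₀).symm (extChartAt (𝓡 n) x₀ x) = x :=
    (extChartAt (𝓡 n) x₀).left_inv (by simpa using hx)
  unfold gram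
  rw [hinv]

theorem gram_symm (g : Metric n M) (x₀ : M) (y u v : Coord n) :
    gram g x₀ y u v = gram g x₀ y v u := by
  rw [gram_apply, gram_apply, g.symm]

theorem isInvertible_gram (g : Metric n M) {x₀ : M} {y : Coord n}
    (hy : y ∈ (extChartAt (𝓡 n) x₀).target) : (gram g x₀ y).IsInvertible := by
  refine isInvertible_of_pos _ fun v hv => ?_
  rw [gram_apply]
  refine g.pos _ _ fun h => hv ?_
  have hx : (extChartAt (𝓡 n) x₀).symm y ∈ (chartAt (Coord n) x₀).source := by
    simpa using (extChartAt (𝓡 n) x₀).map_target hy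
  rw [← components_frame hx v, h, map_zero]

/-- In the trivialisation that defines it, the frame field is constant. -/
theorem contMDiffAt_frame {x₀ x : M} (hx : x ∈ (chartAt (Coord n) x₀).source) (v : Coord n) :
    ContMDiffAt (𝓡 n) ((𝓡 n).prod 𝓘(ℝ, Coord n)) ∞
      (fun x : M => Bundle.TotalSpace.mk' (Coord n) (E := fun x : M => TangentSpace (𝓡 n) x)
        x (frame x₀ x v)) x := by
  rw [Bundle.Trivialization.contMDiffAt_section_iff
    (trivializationAt (Coord n) (fun y : M => TangentSpace (𝓡 n) y) x₀) (by simpa using hx)]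
  refine (contMDiffAt_const (c := v)).congr_of_eventuallyEq ?_
  filter_upwards [(chartAt (Coord n) x₀).open_source.mem_nhds hx] with z hz
  rw [← Bundle.Trivialization.continuousLinearMapAt_apply_of_mem (R := ℝ) _ (by simpa using hz)]
  exact components_frame hz v

theorem contDiffAt_gram (g : Metric n M) {x₀ : M} {y : Coord n}
    (hy : y ∈ (extChartAt (𝓡 n) x₀).target) : ContDiffAt ℝ ∞ (gram g x₀) y := by
  -- In finite dimension, smoothness of a map into linear maps can be tested on fixed vectors. Then
  -- only the smooth section g, evaluated on two smooth frame fields, is left.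
  have key : ContDiffOn ℝ ∞ (gram g x₀) (extChartAt (𝓡 n) x₀).target := by
    rw [contDiffOn_clm_apply]
    intro u
    rw [contDiffOn_clm_apply]
    intro v z hz
    have hx : (extChartAt (𝓡 n) x₀).symm z ∈ (chartAt (Coord n) x₀).source := by
      simpa using (extChartAt (𝓡 n) x₀).map_target hz
    have h₁ := ContMDiffAt.clm_bundle_apply₂ (F₁ := Coord n) (F₂ := Coord n) (F₃ := ℝ)
      (E₁ := fun x : M => TangentSpace (𝓡 n) x) (E₂ := fun x : M => TangentSpace (𝓡 n) x)
      (E₃ := Bundle.Trivial M ℝ) (b := fun x : M => x)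
      (g.contMDiff ((extChartAt (𝓡 n) x₀).symm z)) (contMDiffAt_frame hx u)
      (contMDiffAt_frame hx v)
    have h₂ := ((Bundle.contMDiffAt_totalSpace).mp h₁).2
    have h₃ : ContMDiffWithinAt 𝓘(ℝ, Coord n) 𝓘(ℝ, ℝ) ∞ (fun y => gram g x₀ y u v)
        (extChartAt (𝓡 n) x₀).target z :=
      ContMDiffAt.comp_contMDiffWithinAt (I' := 𝓡 n) z h₂
        (contMDiffOn_extChartAt_symm (n := ∞) x₀ z hz)
    exact h₃.contDiffWithinAt
  exact key.contDiffAt ((isOpen_extChartAt_target x₀).mem_nhds hy)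

end Charts

/-! ### The curve in a fixed chart: velocity, speed, unit tangent; Christoffel symbols. -/

section CurvesInCharts

variable {n : ℕ} {M : Type*} [TopologicalSpace M] [ChartedSpace (Coord n) M]

/-- Components of the unit tangent vector in the chart around `x₀`. -/
def unitComponents [IsManifold (𝓡 n) ∞ M] (g : Metric n M) (γ : ℝ → M) (x₀ : M) (t : ℝ) :
    Coord n :=
  components x₀ (γ t) (unitTangent g γ t)

theorem IsOrientedCurve.mdifferentiableAt {γ : ℝ → M} {I : Set ℝ} (h : IsOrientedCurve n γ I)
    {r : ℝ} (hr : r ∈ I) : MDifferentiableAt 𝓘(ℝ, ℝ) (𝓡 n) γ r :=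
  (h.smooth.contMDiffAt (h.isOpen.mem_nhds hr)).mdifferentiableAt (by simp)

theorem IsOrientedCurve.eventually_mem_source {γ : ℝ → M} {I : Set ℝ}
    (h : IsOrientedCurve n γ I) {r : ℝ} (hr : r ∈ I) {x₀ : M}
    (hx : γ r ∈ (chartAt (Coord n) x₀).source) :
    ∀ᶠ t in 𝓝 r, t ∈ I ∧ γ t ∈ (chartAt (Coord n) x₀).source :=
  Filter.Eventually.and (h.isOpen.mem_nhds hr)
    ((h.mdifferentiableAt hr).continuousAt ((chartAt (Coord n) x₀).open_source.mem_nhds hx))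

theorem mem_extChartAt_target_of_mem {x₀ x : M} (hx : x ∈ (chartAt (Coord n) x₀).source) :
    extChartAt (𝓡 n) x₀ x ∈ (extChartAt (𝓡 n) x₀).target :=
  (extChartAt (𝓡 n) x₀).map_source (by simpa using hx)

variable [IsManifold (𝓡 n) ∞ M]

theorem gram_components (g : Metric n M) {x₀ x : M} (hx : x ∈ (chartAt (Coord n) x₀).source)
    (u v : Tan (n := n) x) :
    gram g x₀ (extChartAt (𝓡 n) x₀ x) (components x₀ x u) (components x₀ x v)
      = g.inner x u v := by
  rw [gram_extChartAt g hx, bilComponents_apply, frame_components hx, frame_components hx]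

theorem covComponents_components {x₀ x : M} (hx : x ∈ (chartAt (Coord n) x₀).source)
    (α : Cov (n := n) x) (v : Tan (n := n) x) :
    covComponents x₀ α (components x₀ x v) = α v := by
  rw [covComponents_apply, frame_components hx]

theorem covComponents_injective {x₀ x : M} (hx : x ∈ (chartAt (Coord n) x₀).source)
    {α β : Cov (n := n) x} (h : covComponents x₀ α = covComponents x₀ β) : α = β := by
  ext v
  rw [← covComponents_components hx α v, h, covComponents_components hx]

theorem covComponents_inner (g : Metric n M) {x₀ x : M}
    (hx : x ∈ (chartAt (Coord n) x₀).source) (v : Tan (n := n) x) :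
    covComponents x₀ (g.inner x v) = gram g x₀ (extChartAt (𝓡 n) x₀ x) (components x₀ x v) := by
  ext w
  rw [gram_extChartAt g hx, bilComponents_apply, covComponents_apply, frame_components hx]

theorem covComponents_covOfComponents {x₀ x : M} (hx : x ∈ (chartAt (Coord n) x₀).source)
    (α : Coord n →L[ℝ] ℝ) : covComponents x₀ (covOfComponents x₀ x α) = α := by
  ext w
  show α (components x₀ x (frame x₀ x w)) = α w
  rw [components_frame hx]

section

variable {γ : ℝ → M} {I : Set ℝ} (h : IsOrientedCurve n γ I) (g : Metric n M) {r : ℝ} (hr : r ∈ I)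
  {x₀ : M} (hx : γ r ∈ (chartAt (Coord n) x₀).source)

include h hr

theorem IsOrientedCurve.inner_velocity_pos : 0 < g.inner (γ r) (velocity γ r) (velocity γ r) :=
  g.pos _ _ (h.regular r hr)

theorem IsOrientedCurve.speed_pos : 0 < speed g γ r :=
  Real.sqrt_pos.mpr (h.inner_velocity_pos g hr)

theorem IsOrientedCurve.inner_unitTangent :
    g.inner (γ r) (unitTangent g γ r) (unitTangent g γ r) = 1 := by
  have h0 := h.speed_pos g hr
  have h1 : g.inner (γ r) (velocity γ r) (velocity γ r) = speed g γ r ^ 2 :=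
    (Real.sq_sqrt (h.inner_velocity_pos g hr).le).symm
  unfold unitTangent
  simp only [map_smul, smul_apply, smul_eq_mul, h1]
  field_simp

theorem IsOrientedCurve.velocity_eq : velocity γ r = speed g γ r • unitTangent g γ r := by
  rw [unitTangent, smul_smul, mul_inv_cancel₀ (h.speed_pos g hr).ne', one_smul]

include hx

theorem IsOrientedCurve.contDiffAt_coord :
    ContDiffAt ℝ ∞ (fun t => extChartAt (𝓡 n) x₀ (γ t)) r := by
  rw [← contMDiffAt_iff_contDiffAt]
  exact ContMDiffAt.comp (I' := 𝓡 n) r (contMDiffAt_extChartAt' hx)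
    (h.smooth.contMDiffAt (h.isOpen.mem_nhds hr))

theorem IsOrientedCurve.hasDerivAt_coord :
    HasDerivAt (fun t => extChartAt (𝓡 n) x₀ (γ t)) (speed g γ r • unitComponents g γ x₀ r) r := by
  have h1 := hasDerivAt_extChartAt_comp (h.mdifferentiableAt hr) hx
  rw [h.velocity_eq g hr, map_smul] at h1
  exact h1

theorem IsOrientedCurve.contDiffAt_components_velocity :
    ContDiffAt ℝ ∞ (fun t => components x₀ (γ t) (velocity (n := n) γ t)) r := by
  have h1 : ContDiffAt ℝ ∞ (fun t => fderiv ℝ (fun t => extChartAt (𝓡 n) x₀ (γ t)) t 1) r :=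
    ((h.contDiffAt_coord hr hx).fderiv_right (by simp)).clm_apply contDiffAt_const
  refine h1.congr_of_eventuallyEq ?_
  filter_upwards [h.eventually_mem_source hr hx] with t ht
  exact (hasDerivAt_extChartAt_comp (h.mdifferentiableAt ht.1) ht.2).deriv.symm

theorem IsOrientedCurve.contDiffAt_gram :
    ContDiffAt ℝ ∞ (fun t => gram g x₀ (extChartAt (𝓡 n) x₀ (γ t))) r :=
  ContDiffAt.comp r (ConformalCircles.contDiffAt_gram g (mem_extChartAt_target_of_mem hx))
    (h.contDiffAt_coord hr hx)

/-- Regularity of the curve enters here, since the square root is smooth only away from 0. -/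
theorem IsOrientedCurve.contDiffAt_speed : ContDiffAt ℝ ∞ (speed g γ) r := by
  have h1 := ((h.contDiffAt_gram g hr hx).clm_apply
    (h.contDiffAt_components_velocity hr hx)).clm_apply (h.contDiffAt_components_velocity hr hx)
  have h2 : ContDiffAt ℝ ∞ (fun t => g.inner (γ t) (velocity γ t) (velocity γ t)) r := by
    refine h1.congr_of_eventuallyEq ?_
    filter_upwards [h.eventually_mem_source hr hx] with t ht
    rw [gram_components g ht.2]
  exact h2.sqrt (h.inner_velocity_pos g hr).ne'

theorem IsOrientedCurve.contDiffAt_unitComponents :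
    ContDiffAt ℝ ∞ (unitComponents g γ x₀) r := by
  have h3 := ((h.contDiffAt_speed g hr hx).inv (h.speed_pos g hr).ne').smul
    (h.contDiffAt_components_velocity hr hx)
  refine h3.congr_of_eventuallyEq (Filter.Eventually.of_forall fun t => ?_)
  simp [unitComponents, unitTangent]

theorem IsOrientedCurve.covComponents_unitCotangent_eventuallyEq :
    (fun t => covComponents x₀ (unitCotangent g γ t)) =ᶠ[𝓝 r]
      fun t => gram g x₀ (extChartAt (𝓡 n) x₀ (γ t)) (unitComponents g γ x₀ t) := by
  filter_upwards [h.eventually_mem_source hr hx] with t ht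
  exact covComponents_inner g ht.2 _

theorem IsOrientedCurve.contDiffAt_unitCotangent :
    ContDiffAt ℝ ∞ (fun t => covComponents x₀ (unitCotangent g γ t)) r :=
  ((h.contDiffAt_gram g hr hx).clm_apply
    (h.contDiffAt_unitComponents g hr hx)).congr_of_eventuallyEq
    (h.covComponents_unitCotangent_eventuallyEq g hr hx)

end

/-! ### Christoffel symbols -/

theorem hasFDerivAt_gram (g : Metric n M) {x₀ : M} {y : Coord n}
    (hy : y ∈ (extChartAt (𝓡 n) x₀).target) :
    HasFDerivAt (gram g x₀) (fderiv ℝ (gram g x₀) y) y :=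
  ((contDiffAt_gram g hy).differentiableAt (by simp)).hasFDerivAt

theorem fderiv_gram_symm (g : Metric n M) {x₀ : M} {y : Coord n}
    (hy : y ∈ (extChartAt (𝓡 n) x₀).target) (w u v : Coord n) :
    fderiv ℝ (gram g x₀) y w u v = fderiv ℝ (gram g x₀) y w v u := by
  have key : ∀ u v : Coord n, HasFDerivAt (fun z => gram g x₀ z u v)
      (((fderiv ℝ (gram g x₀) y).flip u).flip v) y := fun u v => by
    have := ((hasFDerivAt_gram g hy).clm_apply (hasFDerivAt_const u y)).clm_apply
      (hasFDerivAt_const v y)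
    simpa using this
  have h1 := key u v
  simp_rw [fun z => gram_symm g x₀ z u v] at h1
  exact congrArg (fun L : Coord n →L[ℝ] ℝ => L w) (h1.unique (key v u))

theorem christoffelLower_apply (g : Metric n M) (x₀ : M) (y u v w : Coord n) :
    christoffelLower g x₀ y u v w = 1 / 2 * (fderiv ℝ (gram g x₀) y u v w
      + fderiv ℝ (gram g x₀) y v u w - fderiv ℝ (gram g x₀) y w u v) := by
  rfl

/-- `christoffel` uses the total function `inverse`, which is a true inverse only where `gram` is
invertible, as it is on the chart target. -/
theorem gram_christoffel (g : Metric n M) {x₀ : M} {y : Coord n}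
    (hy : y ∈ (extChartAt (𝓡 n) x₀).target) (u v : Coord n) :
    gram g x₀ y (christoffel g x₀ y u v) = christoffelLower g x₀ y u v :=
  (isInvertible_gram g hy).self_apply_inverse _

end CurvesInCharts

/-! ### The acceleration: Lagrangian form, independence of the chart, Leibniz rule. -/

section Acceleration

variable {n : ℕ} {M : Type*} [TopologicalSpace M] [ChartedSpace (Coord n) M]
  [IsManifold (𝓡 n) ∞ M]

/-- The components of the acceleration in the chart around `x₀`, in Lagrangian form:
`∂ U_k - ½ (∂_k g_ij) U^i U^j`. -/
def accelerationComponents (g : Metric n M) (γ : ℝ → M) (x₀ : M) (t : ℝ) : Coord n →L[ℝ] ℝ :=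
  (speed g γ t)⁻¹ • deriv (fun t => covComponents x₀ (unitCotangent g γ t)) t
    - (1 / 2 : ℝ) • (((fderiv ℝ (gram g x₀) (extChartAt (𝓡 n) x₀ (γ t))).flip
        (unitComponents g γ x₀ t)).flip (unitComponents g γ x₀ t))

theorem accelerationComponents_apply (g : Metric n M) (γ : ℝ → M) (x₀ : M) (t : ℝ)
    (w : Coord n) : accelerationComponents g γ x₀ t w
      = (speed g γ t)⁻¹ * deriv (fun t => covComponents x₀ (unitCotangent g γ t)) t w
        - 1 / 2 * fderiv ℝ (gram g x₀) (extChartAt (𝓡 n) x₀ (γ t)) w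
          (unitComponents g γ x₀ t) (unitComponents g γ x₀ t) := rfl

theorem covComponents_transition {x₀ x₁ x : M} (hx : x ∈ (chartAt (Coord n) x₀).source)
    (hx₁ : x ∈ (chartAt (Coord n) x₁).source) (α : Cov (n := n) x) :
    covComponents x₀ α = (covComponents x₁ α).comp
      (fderiv ℝ (transition x₀ x₁) (extChartAt (𝓡 n) x₀ x)) := by
  rw [(hasFDerivAt_transition hx hx₁).fderiv]
  ext w
  show _ = covComponents x₁ α (components x₁ x (frame x₀ x w))
  rw [covComponents_components hx₁, covComponents_apply]

theorem components_transition {x₀ x₁ x : M} (hx : x ∈ (chartAt (Coord n) x₀).source)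
    (hx₁ : x ∈ (chartAt (Coord n) x₁).source) (v : Tan (n := n) x) :
    fderiv ℝ (transition x₀ x₁) (extChartAt (𝓡 n) x₀ x) (components x₀ x v)
      = components x₁ x v := by
  rw [(hasFDerivAt_transition hx hx₁).fderiv]
  show components x₁ x (frame x₀ x (components x₀ x v)) = _
  rw [frame_components hx]

theorem gram_transition (g : Metric n M) {x₀ x₁ x : M}
    (hx : x ∈ (chartAt (Coord n) x₀).source) (hx₁ : x ∈ (chartAt (Coord n) x₁).source) :
    ∀ᶠ z in 𝓝 (extChartAt (𝓡 n) x₀ x), ∀ u v, gram g x₀ z u v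
      = gram g x₁ (transition x₀ x₁ z) (fderiv ℝ (transition x₀ x₁) z u)
        (fderiv ℝ (transition x₀ x₁) z v) := by
  have hinv : (extChartAt (𝓡 n) x₀).symm (extChartAt (𝓡 n) x₀ x) = x :=
    (extChartAt (𝓡 n) x₀).left_inv (by simpa using hx)
  have hcont : ContinuousAt (extChartAt (𝓡 n) x₀).symm (extChartAt (𝓡 n) x₀ x) :=
    continuousAt_extChartAt_symm' (by simpa using hx)
  have hev : ∀ᶠ z in 𝓝 (extChartAt (𝓡 n) x₀ x),
      (extChartAt (𝓡 n) x₀).symm z ∈ (chartAt (Coord n) x₁).source :=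
    hcont (by rw [hinv]; exact (chartAt (Coord n) x₁).open_source.mem_nhds hx₁)
  filter_upwards [eventually_mem_target hx, hev] with z hz hz₁ u v
  have hz₀ : (extChartAt (𝓡 n) x₀).symm z ∈ (chartAt (Coord n) x₀).source := by
    simpa using (extChartAt (𝓡 n) x₀).map_target hz
  have hrz : extChartAt (𝓡 n) x₀ ((extChartAt (𝓡 n) x₀).symm z) = z :=
    (extChartAt (𝓡 n) x₀).right_inv hz
  have hc : ∀ w : Coord n, fderiv ℝ (transition x₀ x₁) z w
      = components x₁ _ (frame x₀ ((extChartAt (𝓡 n) x₀).symm z) w) := fun w => by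
    have := components_transition hz₀ hz₁ (frame x₀ _ w)
    rwa [components_frame hz₀, hrz] at this
  rw [hc, hc, transition, gram_components g hz₁, gram_apply]

/-- This is the derivative of the pullback formula `gram_transition`. The two terms in which the
transition's differential is differentiated agree by symmetry of g, whence the factor 2. -/
theorem fderiv_gram_transition (g : Metric n M) {x₀ x₁ x : M}
    (hx : x ∈ (chartAt (Coord n) x₀).source) (hx₁ : x ∈ (chartAt (Coord n) x₁).source)
    (w u : Coord n) :
    fderiv ℝ (gram g x₀) (extChartAt (𝓡 n) x₀ x) w u u
      = fderiv ℝ (gram g x₁) (extChartAt (𝓡 n) x₁ x)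
          (fderiv ℝ (transition x₀ x₁) (extChartAt (𝓡 n) x₀ x) w)
          (fderiv ℝ (transition x₀ x₁) (extChartAt (𝓡 n) x₀ x) u)
          (fderiv ℝ (transition x₀ x₁) (extChartAt (𝓡 n) x₀ x) u)
        + 2 * gram g x₁ (extChartAt (𝓡 n) x₁ x)
          (fderiv ℝ (transition x₀ x₁) (extChartAt (𝓡 n) x₀ x) u)
          (fderiv ℝ (fderiv ℝ (transition x₀ x₁)) (extChartAt (𝓡 n) x₀ x) w u) := by
  have hinv : (extChartAt (𝓡 n) x₀).symm (extChartAt (𝓡 n) x₀ x) = x :=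
    (extChartAt (𝓡 n) x₀).left_inv (by simpa using hx)
  have hφ := contDiffAt_transition hx hx₁
  have hφ₁ : HasFDerivAt (transition x₀ x₁) _ (extChartAt (𝓡 n) x₀ x) :=
    (hφ.differentiableAt (by simp)).hasFDerivAt
  have hφ₂ : HasFDerivAt (fderiv ℝ (transition x₀ x₁)) _ (extChartAt (𝓡 n) x₀ x) :=
    ((hφ.fderiv_right (m := ∞) (by simp)).differentiableAt (by simp)).hasFDerivAt
  have htr : transition x₀ x₁ (extChartAt (𝓡 n) x₀ x) = extChartAt (𝓡 n) x₁ x := by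
    rw [transition, hinv]
  have hG₁ : HasFDerivAt (gram g x₁) (fderiv ℝ (gram g x₁) (extChartAt (𝓡 n) x₁ x))
      (transition x₀ x₁ (extChartAt (𝓡 n) x₀ x)) := by
    rw [htr]
    exact hasFDerivAt_gram g (mem_extChartAt_target_of_mem hx₁)
  have hu := hφ₂.clm_apply (hasFDerivAt_const u (extChartAt (𝓡 n) x₀ x))
  have h1 := ((hG₁.comp _ hφ₁).clm_apply hu).clm_apply hu
  have h0 := ((hasFDerivAt_gram g (mem_extChartAt_target_of_mem hx)).clm_apply
    (hasFDerivAt_const u _)).clm_apply (hasFDerivAt_const u (extChartAt (𝓡 n) x₀ x))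
  have h2 := h0.unique (h1.congr_of_eventuallyEq
    ((gram_transition g hx hx₁).mono fun z hz => hz u u))
  have h3 := congrArg (fun L : Coord n →L[ℝ] ℝ => L w) h2
  simp only [add_apply, ContinuousLinearMap.comp_apply, ContinuousLinearMap.flip_apply,
    zero_apply, map_zero, zero_add, Function.comp_apply, htr] at h3
  rw [h3, gram_symm g x₁ _ (fderiv ℝ (fderiv ℝ (transition x₀ x₁)) _ w u)]
  ring

variable {γ : ℝ → M} {I : Set ℝ}

/-- The Lagrangian expression for the acceleration transforms as a covector. -/
theorem IsOrientedCurve.accelerationComponents_transition (h : IsOrientedCurve n γ I)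
    (g : Metric n M) {r : ℝ} (hr : r ∈ I) {x₀ x₁ : M}
    (hx : γ r ∈ (chartAt (Coord n) x₀).source) (hx₁ : γ r ∈ (chartAt (Coord n) x₁).source) :
    accelerationComponents g γ x₀ r = (accelerationComponents g γ x₁ r).comp
      (fderiv ℝ (transition x₀ x₁) (extChartAt (𝓡 n) x₀ (γ r))) := by
  have hφ := contDiffAt_transition hx hx₁
  have hφ₂ : HasFDerivAt (fderiv ℝ (transition x₀ x₁)) _ (extChartAt (𝓡 n) x₀ (γ r)) :=
    ((hφ.fderiv_right (m := ∞) (by simp)).differentiableAt (by simp)).hasFDerivAt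
  -- The second derivative D²φ of the transition enters twice: as U(D²φ(U, w)) from differentiating
  -- U_k, and as U(D²φ(w, U)) from the derivative of g. Its symmetry makes them cancel.
  have hsymm := hφ.isSymmSndFDerivAt (by
    rw [minSmoothness_of_isRCLikeNormedField]
    exact WithTop.coe_le_coe.2 (le_top : (2 : ℕ∞) ≤ ⊤))
  have hφt := hφ₂.comp_hasDerivAt r (h.hasDerivAt_coord g hr hx)
  have hα := ((h.contDiffAt_unitCotangent g hr hx₁).differentiableAt (by simp)).hasDerivAt
  have hcomp := hα.clm_comp hφt
  have hev : (fun t => covComponents x₀ (unitCotangent g γ t)) =ᶠ[𝓝 r]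
      fun t => (covComponents x₁ (unitCotangent g γ t)).comp
        ((fderiv ℝ (transition x₀ x₁) ∘ fun t => extChartAt (𝓡 n) x₀ (γ t)) t) := by
    filter_upwards [h.eventually_mem_source hr hx, h.eventually_mem_source hr hx₁] with t ht ht₁
    exact covComponents_transition ht.2 ht₁.2 _
  have hd := (hcomp.congr_of_eventuallyEq hev).deriv
  have hs := (h.speed_pos g hr).ne'
  have hu : fderiv ℝ (transition x₀ x₁) (extChartAt (𝓡 n) x₀ (γ r)) (unitComponents g γ x₀ r)
      = unitComponents g γ x₁ r := components_transition hx hx₁ _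
  have hα₁ := covComponents_inner g hx₁ (unitTangent g γ r)
  ext w
  rw [ContinuousLinearMap.comp_apply, accelerationComponents_apply, accelerationComponents_apply,
    hd, fderiv_gram_transition g hx hx₁, hu]
  simp only [add_apply, ContinuousLinearMap.comp_apply, map_smul, smul_apply, smul_eq_mul,
    Function.comp_apply]
  have e1 : covComponents x₁ (unitCotangent g γ r)
      = gram g x₁ (extChartAt (𝓡 n) x₁ (γ r)) (unitComponents g γ x₁ r) := hα₁
  rw [e1, hsymm.eq w (unitComponents g γ x₀ r)]
  field_simp
  ring

/-- In g(Γ(U, w), U) the two terms that differentiate g along U cancel, leaving half the derivative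
of g(U, U) along w. -/
theorem covComponents_acceleration_self (g : Metric n M) (γ : ℝ → M) (r : ℝ) :
    covComponents (γ r) (acceleration g γ r) = accelerationComponents g γ (γ r) r := by
  have hx : γ r ∈ (chartAt (Coord n) (γ r)).source := mem_chart_source _ _
  have hy := mem_extChartAt_target_of_mem hx
  ext w
  rw [acceleration, delCov, covComponents_covOfComponents hx, accelerationComponents_apply]
  have e1 : covComponents (γ r) (unitCotangent g γ r)
      = gram g (γ r) (extChartAt (𝓡 n) (γ r) (γ r)) (unitComponents g γ (γ r) r) :=
    covComponents_inner g hx _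
  have e2 : connectionAlong g γ r w = christoffel g (γ r) (extChartAt (𝓡 n) (γ r) (γ r))
      (unitComponents g γ (γ r) r) w := rfl
  simp only [sub_apply, smul_apply, smul_eq_mul, ContinuousLinearMap.comp_apply]
  rw [e1, e2, gram_symm, gram_christoffel g hy, christoffelLower_apply,
    fderiv_gram_symm g hy _ w]
  ring

/-- Here the chart around `γ r`, used to define the acceleration, is replaced by a fixed one, so
that the acceleration can be differentiated in r. -/
theorem IsOrientedCurve.covComponents_acceleration (h : IsOrientedCurve n γ I)
    (g : Metric n M) {r : ℝ} (hr : r ∈ I) {x₀ : M} (hx : γ r ∈ (chartAt (Coord n) x₀).source) :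
    covComponents x₀ (acceleration g γ r) = accelerationComponents g γ x₀ r := by
  have hx₁ : γ r ∈ (chartAt (Coord n) (γ r)).source := mem_chart_source _ _
  rw [h.accelerationComponents_transition g hr hx hx₁, ← covComponents_acceleration_self g γ r,
    covComponents_transition hx hx₁]

theorem contDiffAt_flip {E F G : Type*} [NormedAddCommGroup E] [NormedSpace ℝ E]
    [NormedAddCommGroup F] [NormedSpace ℝ F] [NormedAddCommGroup G] [NormedSpace ℝ G]
    {f : ℝ → E →L[ℝ] F →L[ℝ] G} {r : ℝ} (hf : ContDiffAt ℝ ∞ f r) :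
    ContDiffAt ℝ ∞ (fun t => (f t).flip) r :=
  ((ContinuousLinearMap.flipₗᵢ ℝ E F G).toContinuousLinearEquiv.contDiff.contDiffAt).comp r hf

theorem IsOrientedCurve.contDiffAt_acceleration (h : IsOrientedCurve n γ I)
    (g : Metric n M) {r : ℝ} (hr : r ∈ I) {x₀ : M} (hx : γ r ∈ (chartAt (Coord n) x₀).source) :
    ContDiffAt ℝ ∞ (fun t => covComponents x₀ (acceleration g γ t)) r := by
  have h1 : ContDiffAt ℝ ∞
      (fun t => deriv (fun t => covComponents x₀ (unitCotangent g γ t)) t) r :=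
    ((h.contDiffAt_unitCotangent g hr hx).fderiv_right (by simp)).clm_apply contDiffAt_const
  have h2 : ContDiffAt ℝ ∞ (fun t => fderiv ℝ (gram g x₀) (extChartAt (𝓡 n) x₀ (γ t))) r :=
    ((ConformalCircles.contDiffAt_gram g (mem_extChartAt_target_of_mem hx)).fderiv_right
      (by simp)).comp r (h.contDiffAt_coord hr hx)
  have hU := h.contDiffAt_unitComponents g hr hx
  have h3 : ContDiffAt ℝ ∞ (accelerationComponents g γ x₀) r :=
    (((h.contDiffAt_speed g hr hx).inv (h.speed_pos g hr).ne').smul h1).sub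
      (((contDiffAt_flip ((contDiffAt_flip h2).clm_apply hU)).clm_apply hU).const_smul (1 / 2 : ℝ))
  refine h3.congr_of_eventuallyEq ?_
  filter_upwards [h.eventually_mem_source hr hx] with t ht
  exact h.covComponents_acceleration g ht.1 ht.2

/-! ### Differentiation of scalar products along the curve -/

/-- The acceleration vector is `∂ U^a`. -/
theorem IsOrientedCurve.components_sharp_acceleration (h : IsOrientedCurve n γ I)
    (g : Metric n M) {r : ℝ} (hr : r ∈ I) :
    components (γ r) (γ r) (sharp g (acceleration g γ r))
      = (speed g γ r)⁻¹ • deriv (unitComponents g γ (γ r)) r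
        + connectionAlong g γ r (unitComponents g γ (γ r) r) := by
  have hx : γ r ∈ (chartAt (Coord n) (γ r)).source := mem_chart_source _ _
  have hy := mem_extChartAt_target_of_mem hx
  -- After lowering the index, Γ becomes the Christoffel symbol of the first kind and the left side
  -- the Lagrangian form of A.
  refine (isInvertible_gram g hy).injective ?_
  rw [← covComponents_inner g hx, inner_sharp, covComponents_acceleration_self g γ r]
  have hG := (hasFDerivAt_gram g hy).comp_hasDerivAt r (h.hasDerivAt_coord g hr hx)
  have hU := ((h.contDiffAt_unitComponents g hr hx).differentiableAt (by simp)).hasDerivAt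
  have hd := ((hG.clm_apply hU).congr_of_eventuallyEq
    (h.covComponents_unitCotangent_eventuallyEq g hr hx)).deriv
  have e2 : connectionAlong g γ r (unitComponents g γ (γ r) r)
    = christoffel g (γ r) (extChartAt (𝓡 n) (γ r) (γ r)) (unitComponents g γ (γ r) r)
      (unitComponents g γ (γ r) r) := rfl
  have hs := (h.speed_pos g hr).ne'
  ext w
  rw [map_add, e2, gram_christoffel g hy, accelerationComponents_apply, hd]
  simp only [add_apply, map_smul, smul_apply, smul_eq_mul, christoffelLower_apply,
    Function.comp_apply]
  field_simp
  ring

/-- This is the Leibniz rule for the contraction of α with U, where ∂U is the raised acceleration.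
The orthogonality relations come from it. -/
theorem IsOrientedCurve.delCov_unitTangent (h : IsOrientedCurve n γ I) (g : Metric n M) {r : ℝ}
    (hr : r ∈ I) {α : ∀ t, Cov (n := n) (γ t)}
    (hα : DifferentiableAt ℝ (fun t => covComponents (γ r) (α t)) r) :
    delCov g γ α r (unitTangent g γ r) = delFun g γ (fun t => α t (unitTangent g γ t)) r
      - α r (sharp g (acceleration g γ r)) := by
  have hx : γ r ∈ (chartAt (Coord n) (γ r)).source := mem_chart_source _ _
  have hU := ((h.contDiffAt_unitComponents g hr hx).differentiableAt (by simp)).hasDerivAt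
  have hev : (fun t => α t (unitTangent g γ t)) =ᶠ[𝓝 r]
      fun t => covComponents (γ r) (α t) (unitComponents g γ (γ r) t) := by
    filter_upwards [h.eventually_mem_source hr hx] with t ht
    exact (covComponents_components ht.2 _ _).symm
  have hd := ((hα.hasDerivAt.clm_apply hU).congr_of_eventuallyEq hev).deriv
  rw [delFun, hd, ← covComponents_components hx (delCov g γ α r),
    ← covComponents_components hx (α r), h.components_sharp_acceleration g hr, delCov,
    covComponents_covOfComponents hx]
  simp [unitComponents]
  ring

end Acceleration

/-! ### Orthogonality relations, conformal change of the acceleration, product rules. -/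

section MovingFrame

variable {n : ℕ} {M : Type*} [TopologicalSpace M] [ChartedSpace (Coord n) M]
  [IsManifold (𝓡 n) ∞ M] {γ : ℝ → M} {I : Set ℝ}

/-! ### Orthogonality relations -/

theorem unitCotangent_sharp (g : Metric n M) (γ : ℝ → M) (r : ℝ) (α : Cov (n := n) (γ r)) :
    unitCotangent g γ r (sharp g α) = α (unitTangent g γ r) :=
  inner_apply_sharp g α _

@[simp] theorem sharp_unitCotangent (g : Metric n M) (γ : ℝ → M) (r : ℝ) :
    sharp g (unitCotangent g γ r) = unitTangent g γ r :=
  sharp_inner g _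

theorem IsOrientedCurve.unitCotangent_unitTangent (h : IsOrientedCurve n γ I) (g : Metric n M)
    {r : ℝ} (hr : r ∈ I) : unitCotangent g γ r (unitTangent g γ r) = 1 :=
  h.inner_unitTangent g hr

theorem delFun_of_eventuallyEq_const (g : Metric n M) (γ : ℝ → M) {f : ℝ → ℝ} {k r : ℝ}
    (hf : f =ᶠ[𝓝 r] fun _ => k) : delFun g γ f r = 0 := by
  rw [delFun, hf.deriv_eq, deriv_const, mul_zero]

/-- Differentiating U_a U^a = 1 yields A·U = -A·U. -/
theorem IsOrientedCurve.acceleration_unitTangent (h : IsOrientedCurve n γ I) (g : Metric n M)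
    {r : ℝ} (hr : r ∈ I) : acceleration g γ r (unitTangent g γ r) = 0 := by
  have h1 := h.delCov_unitTangent g hr (α := unitCotangent g γ)
    ((h.contDiffAt_unitCotangent g hr (mem_chart_source _ _)).differentiableAt (by simp))
  rw [delFun_of_eventuallyEq_const (k := 1), unitCotangent_sharp] at h1
  · change acceleration g γ r (unitTangent g γ r) = _ at h1
    linarith
  · filter_upwards [h.isOpen.mem_nhds hr] with t ht
    exact h.unitCotangent_unitTangent g ht

theorem IsOrientedCurve.delCov_acceleration_unitTangent (h : IsOrientedCurve n γ I)
    (g : Metric n M) {r : ℝ} (hr : r ∈ I) :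
    delCov g γ (acceleration g γ) r (unitTangent g γ r)
      = - coInner g (acceleration g γ r) (acceleration g γ r) := by
  rw [h.delCov_unitTangent g hr
    ((h.contDiffAt_acceleration g hr (mem_chart_source _ _)).differentiableAt (by simp)),
    delFun_of_eventuallyEq_const (k := 0), zero_sub, coInner]
  filter_upwards [h.isOpen.mem_nhds hr] with t ht
  exact h.acceleration_unitTangent g ht

/-- The coefficient of U_a in J_a is exactly what cancels U·∂A = -A·A and -P(U, U). This is why J
has to vanish once it is a multiple of U. -/
theorem IsOrientedCurve.normalisedJerk_unitTangent (h : IsOrientedCurve n γ I)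
    (c : Structure n M) (g : c.metrics) {r : ℝ} (hr : r ∈ I) :
    normalisedJerk c g γ r (unitTangent g.1 γ r) = 0 := by
  simp only [normalisedJerk, sub_apply, add_apply, smul_apply, smul_eq_mul,
    h.delCov_acceleration_unitTangent g.1 hr, h.unitCotangent_unitTangent g.1 hr]
  ring

/-! ### Conformal change -/

section

variable (h : IsOrientedCurve n γ I) {g g' : Metric n M} {Ω : M → ℝ}
  (hΩ : IsConformalFactor g g' Ω) {r : ℝ} (hr : r ∈ I)

include hΩ

theorem IsConformalFactor.speed_eq (γ : ℝ → M) (r : ℝ) :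
    speed g' γ r = Ω (γ r) * speed g γ r := by
  rw [speed, hΩ.eq, Real.sqrt_mul (sq_nonneg _), Real.sqrt_sq (hΩ.pos _).le, speed]

theorem IsConformalFactor.unitTangent_eq (γ : ℝ → M) (r : ℝ) :
    unitTangent g' γ r = (Ω (γ r))⁻¹ • unitTangent g γ r := by
  rw [unitTangent, hΩ.speed_eq, unitTangent, smul_smul, mul_inv]

theorem IsConformalFactor.unitCotangent_eq (γ : ℝ → M) (r : ℝ) :
    unitCotangent g' γ r = Ω (γ r) • unitCotangent g γ r := by
  have h0 := (hΩ.pos (γ r)).ne'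
  rw [unitCotangent, hΩ.inner_eq, hΩ.unitTangent_eq, map_smul, smul_smul, unitCotangent]
  congr 1
  field_simp

include h hr

/-- In Lagrangian form only two new terms arise: Υ(U) U from differentiating Ω in Û_a = Ω U_a, and
-Υ from differentiating Ω² in ĝ, using g(U, U) = 1. The Christoffel symbols of ĝ are not needed. -/
theorem IsOrientedCurve.acceleration_conformal :
    acceleration g' γ r = acceleration g γ r - upsilon Ω (γ r)
      + upsilon Ω (γ r) (unitTangent g γ r) • unitCotangent g γ r := by
  have hx : γ r ∈ (chartAt (Coord n) (γ r)).source := mem_chart_source _ _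
  have hinv : (extChartAt (𝓡 n) (γ r)).symm (extChartAt (𝓡 n) (γ r) (γ r)) = γ r :=
    (extChartAt (𝓡 n) (γ r)).left_inv (by simp)
  have hΩd : MDifferentiableAt (𝓡 n) 𝓘(ℝ, ℝ) Ω (γ r) := hΩ.smooth.mdifferentiableAt (by simp)
  have h0 := (hΩ.pos (γ r)).ne'
  have hs := (h.speed_pos g hr).ne'
  have hΩt := hasDerivAt_comp_curve (h.mdifferentiableAt hr) hΩd
  have hα := ((h.contDiffAt_unitCotangent g hr hx).differentiableAt (by simp)).hasDerivAt
  have hα' : ∀ t, covComponents (γ r) (unitCotangent g' γ t)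
      = Ω (γ t) • covComponents (γ r) (unitCotangent g γ t) := fun t => by
    rw [hΩ.unitCotangent_eq]
    rfl
  have hd := (HasDerivAt.congr_of_eventuallyEq (hΩt.smul hα)
    (Filter.Eventually.of_forall hα')).deriv
  have hω := hasFDerivAt_comp_extChartAt_symm hx hΩd
  have hG := (hω.pow 2).smul (hasFDerivAt_gram g (mem_extChartAt_target_of_mem hx))
  have hgram : ∀ z, gram g' (γ r) z
      = Ω ((extChartAt (𝓡 n) (γ r)).symm z) ^ 2 • gram g (γ r) z := fun z => by
    ext u v
    exact hΩ.eq _ _ _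
  have hG' := (HasFDerivAt.congr_of_eventuallyEq hG (Filter.Eventually.of_forall hgram)).fderiv
  have hU : unitComponents g' γ (γ r) r = (Ω (γ r))⁻¹ • unitComponents g γ (γ r) r := by
    rw [unitComponents, hΩ.unitTangent_eq, map_smul, unitComponents]
  have hUU : gram g (γ r) (extChartAt (𝓡 n) (γ r) (γ r)) (unitComponents g γ (γ r) r)
      (unitComponents g γ (γ r) r) = 1 := by
    rw [unitComponents, gram_components g hx, h.inner_unitTangent g hr]
  refine covComponents_injective hx ?_
  rw [covComponents_acceleration_self]
  ext w
  have hadd : covComponents (γ r) (acceleration g γ r - upsilon Ω (γ r)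
      + upsilon Ω (γ r) (unitTangent g γ r) • unitCotangent g γ r) w
      = covComponents (γ r) (acceleration g γ r) w - covComponents (γ r) (upsilon Ω (γ r)) w
        + upsilon Ω (γ r) (unitTangent g γ r) * covComponents (γ r) (unitCotangent g γ r) w := rfl
  have hΥ : covComponents (γ r) (upsilon (n := n) Ω (γ r)) w
    = (Ω (γ r))⁻¹ * covComponents (γ r) (differential (n := n) Ω (γ r)) w := rfl
  have hΥ' : upsilon Ω (γ r) (unitTangent g γ r)
    = (Ω (γ r))⁻¹ * differential Ω (γ r) (unitTangent g γ r) := rfl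
  rw [hadd, covComponents_acceleration_self, accelerationComponents_apply,
    accelerationComponents_apply, hd, hG', hΥ, hΥ', hU, hΩ.speed_eq, h.velocity_eq g hr]
  simp only [add_apply, map_smul, smul_apply, smul_eq_mul, ContinuousLinearMap.smulRight_apply,
    hUU, hinv]
  field_simp
  ring

end

/-! ### Leibniz rules -/

theorem covComponents_smul (x₀ : M) {x : M} (k : ℝ) (α : Cov (n := n) x) :
    covComponents x₀ (k • α) = k • covComponents x₀ α := rfl

theorem covComponents_add (x₀ : M) {x : M} (α β : Cov (n := n) x) :
    covComponents x₀ (α + β) = covComponents x₀ α + covComponents x₀ β := rfl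

theorem bilComponents_smul (x₀ : M) {x : M} (k : ℝ) (B : Bil (n := n) x) :
    bilComponents x₀ (k • B) = k • bilComponents x₀ B := rfl

theorem bilComponents_wedge (x₀ : M) {x : M} (α β : Cov (n := n) x) :
    bilComponents x₀ (wedge α β) = (covComponents x₀ α).smulRight (covComponents x₀ β)
      - (covComponents x₀ β).smulRight (covComponents x₀ α) := rfl

theorem delCov_congr (g : Metric n M) {r : ℝ} {α β : ∀ t, Cov (n := n) (γ t)}
    (h : ∀ᶠ t in 𝓝 r, α t = β t) : delCov g γ α r = delCov g γ β r := by
  have h1 : (fun t => covComponents (γ r) (α t)) =ᶠ[𝓝 r] fun t => covComponents (γ r) (β t) :=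
    h.mono fun t ht => by simp only [ht]
  rw [delCov, delCov, h1.deriv_eq, h.self_of_nhds]

theorem delBil_congr (g : Metric n M) {r : ℝ} {α β : ∀ t, Bil (n := n) (γ t)}
    (h : ∀ᶠ t in 𝓝 r, α t = β t) : delBil g γ α r = delBil g γ β r := by
  have h1 : (fun t => bilComponents (γ r) (α t)) =ᶠ[𝓝 r] fun t => bilComponents (γ r) (β t) :=
    h.mono fun t ht => by simp only [ht]
  rw [delBil, delBil, h1.deriv_eq, h.self_of_nhds]

theorem delFun_congr (g : Metric n M) {r : ℝ} {f k : ℝ → ℝ}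
    (h : ∀ᶠ t in 𝓝 r, f t = k t) : delFun g γ f r = delFun g γ k r := by
  rw [delFun, delFun, Filter.EventuallyEq.deriv_eq h]

theorem delCov_add (g : Metric n M) {r : ℝ} {α β : ∀ t, Cov (n := n) (γ t)}
    (hα : DifferentiableAt ℝ (fun t => covComponents (γ r) (α t)) r)
    (hβ : DifferentiableAt ℝ (fun t => covComponents (γ r) (β t)) r) :
    delCov g γ (fun t => α t + β t) r = delCov g γ α r + delCov g γ β r := by
  have hd : deriv (fun t => covComponents (γ r) (α t + β t)) r = _ :=
    (hα.hasDerivAt.add hβ.hasDerivAt).deriv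
  ext v
  simp only [delCov, hd]
  simp only [covOfComponents, covComponents_add]
  simp
  ring

theorem delCov_smul (g : Metric n M) {r : ℝ} {f : ℝ → ℝ} {α : ∀ t, Cov (n := n) (γ t)}
    (hf : DifferentiableAt ℝ f r)
    (hα : DifferentiableAt ℝ (fun t => covComponents (γ r) (α t)) r) :
    delCov g γ (fun t => f t • α t) r = delFun g γ f r • α r + f r • delCov g γ α r := by
  have hx : γ r ∈ (chartAt (Coord n) (γ r)).source := mem_chart_source _ _
  have hd : deriv (fun t => covComponents (γ r) (f t • α t)) r = _ :=
    (hf.hasDerivAt.smul hα.hasDerivAt).deriv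
  ext v
  have hv := covComponents_components hx (α r) v
  simp only [delCov, delFun, hd]
  simp only [covOfComponents, covComponents_smul]
  simp [← hv]
  ring

theorem delBil_smul (g : Metric n M) {r : ℝ} {f : ℝ → ℝ} {B : ∀ t, Bil (n := n) (γ t)}
    (hf : DifferentiableAt ℝ f r)
    (hB : DifferentiableAt ℝ (fun t => bilComponents (γ r) (B t)) r) :
    delBil g γ (fun t => f t • B t) r = delFun g γ f r • B r + f r • delBil g γ B r := by
  have hx : γ r ∈ (chartAt (Coord n) (γ r)).source := mem_chart_source _ _
  have hd : deriv (fun t => bilComponents (γ r) (f t • B t)) r = _ :=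
    (hf.hasDerivAt.smul hB.hasDerivAt).deriv
  ext u v
  have hv : bilComponents (γ r) (B r) (components (γ r) (γ r) u) (components (γ r) (γ r) v)
    = B r u v := by rw [bilComponents_apply, frame_components hx, frame_components hx]
  simp only [delBil, delFun, hd]
  simp only [bilOfComponents, bilComponents_smul]
  simp [← hv]
  ring

theorem differentiableAt_wedge {r : ℝ} {x₀ : M} {α β : ∀ t, Cov (n := n) (γ t)}
    (hα : DifferentiableAt ℝ (fun t => covComponents x₀ (α t)) r)
    (hβ : DifferentiableAt ℝ (fun t => covComponents x₀ (β t)) r) :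
    DifferentiableAt ℝ (fun t => bilComponents x₀ (wedge (α t) (β t))) r :=
  ((ContinuousLinearMap.smulRightL ℝ (Coord n) (Coord n →L[ℝ] ℝ)).differentiableAt.comp r
    hα |>.clm_apply hβ).sub
  ((ContinuousLinearMap.smulRightL ℝ (Coord n) (Coord n →L[ℝ] ℝ)).differentiableAt.comp r
    hβ |>.clm_apply hα)

theorem delBil_wedge (g : Metric n M) {r : ℝ} {α β : ∀ t, Cov (n := n) (γ t)}
    (hα : DifferentiableAt ℝ (fun t => covComponents (γ r) (α t)) r)
    (hβ : DifferentiableAt ℝ (fun t => covComponents (γ r) (β t)) r) :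
    delBil g γ (fun t => wedge (α t) (β t)) r
      = wedge (delCov g γ α r) (β r) + wedge (α r) (delCov g γ β r) := by
  have hx : γ r ∈ (chartAt (Coord n) (γ r)).source := mem_chart_source _ _
  have hL : ∀ {α β : ∀ t, Cov (n := n) (γ t)},
      DifferentiableAt ℝ (fun t => covComponents (γ r) (α t)) r →
      DifferentiableAt ℝ (fun t => covComponents (γ r) (β t)) r → HasDerivAt
        (fun t => (covComponents (γ r) (α t)).smulRight (covComponents (γ r) (β t)))
        ((deriv (fun t => covComponents (γ r) (α t)) r).smulRight (covComponents (γ r) (β r))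
          + (covComponents (γ r) (α r)).smulRight (deriv (fun t => covComponents (γ r) (β t)) r))
        r := fun hα hβ =>
    ((ContinuousLinearMap.smulRightL ℝ (Coord n)
      (Coord n →L[ℝ] ℝ)).hasFDerivAt.comp_hasDerivAt r hα.hasDerivAt).clm_apply hβ.hasDerivAt
  have hd : deriv (fun t => bilComponents (γ r) (wedge (α t) (β t))) r = _ :=
    ((hL hα hβ).sub (hL hβ hα)).deriv
  ext u v
  have hv := fun (δ : Cov (n := n) (γ r)) w => covComponents_components hx δ w
  rw [add_apply, add_apply, wedge_apply, wedge_apply, ← hv (α r) u, ← hv (β r) u,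
    ← hv (α r) v, ← hv (β r) v]
  simp only [delBil, delCov, hd]
  simp only [bilOfComponents, covOfComponents, bilComponents_wedge]
  simp
  ring

end MovingFrame

/-! ### The subbundle B: conformal invariance, rank, tractor derivative, the equivalence. -/

section BundleB

variable {n : ℕ} {M : Type*} [TopologicalSpace M] [ChartedSpace (Coord n) M]
  [IsManifold (𝓡 n) ∞ M] {γ : ℝ → M} {I : Set ℝ}

/-! ### The fibres of the subbundle -/

theorem mem_spanB_iff (g : Metric n M) (γ : ℝ → M) (r : ℝ) (t : Slots (n := n) (γ r)) :
    t ∈ spanB g γ r ↔ ∃ a b c : ℝ, t = (c • unitCotangent g γ r,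
      c • wedge (unitCotangent g γ r) (acceleration g γ r), b,
      a • unitCotangent g γ r + b • acceleration g γ r) := by
  rw [spanB, Submodule.mem_span_triple]
  simp [eq_comm]

theorem IsOrientedCurve.rescale_mem_spanB (h : IsOrientedCurve n γ I) {g g' : Metric n M}
    {Ω : M → ℝ} (hΩ : IsConformalFactor g g' Ω) {r : ℝ} (hr : r ∈ I) {t : Slots (n := n) (γ r)}
    (ht : t ∈ spanB g γ r) : rescale g Ω (γ r) t ∈ spanB g' γ r := by
  rw [mem_spanB_iff] at ht ⊢
  obtain ⟨a, b, c, rfl⟩ := ht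
  have h0 := (hΩ.pos (γ r)).ne'
  have hΥ := unitCotangent_sharp g γ r (upsilon Ω (γ r))
  -- The coefficients are forced: the first slot gives c Ω, since Ω² U = Ω Û; the third gives b + c
  -- Υ(U). What then remains of the fourth slot is a multiple of U = Ω⁻¹ Û. In the second slot, U∧U
  -- = 0 removes the Υ(U) U part of Â.
  refine ⟨(a - c * coInner g (acceleration g γ r) (upsilon Ω (γ r))
      + 1 / 2 * c * coInner g (upsilon Ω (γ r)) (upsilon Ω (γ r))
      - (b + c * upsilon Ω (γ r) (unitTangent g γ r))
        * upsilon Ω (γ r) (unitTangent g γ r)) * (Ω (γ r))⁻¹,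
    b + c * upsilon Ω (γ r) (unitTangent g γ r), c * Ω (γ r), ?_⟩
  rw [hΩ.unitCotangent_eq, h.acceleration_conformal hΩ hr]
  refine Prod.ext ?_ (Prod.ext ?_ (Prod.ext ?_ ?_))
  · ext u
    simp [rescale]
    ring
  · ext u v
    simp [rescale]
    ring
  · simp [rescale, coInner, hΥ]
  · ext u
    simp [rescale, coInner, hΥ]
    field_simp
    ring

theorem spanB_skew {g : Metric n M} {r : ℝ} {t : Slots (n := n) (γ r)}
    (ht : t ∈ spanB g γ r) (u : Tan (n := n) (γ r)) : t.2.1 u u = 0 := by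
  obtain ⟨a, b, c, rfl⟩ := (mem_spanB_iff g γ r t).mp ht
  simp
  right; ring

/-- The slots of an adjoint tractor with respect to a metric. -/
def evalSlots (c : Structure n M) (g : c.metrics) (x : M) :
    adjointTractor c x →ₗ[ℝ] Slots (n := n) x :=
  (LinearMap.proj g : (c.metrics → Slots (n := n) x) →ₗ[ℝ] Slots (n := n) x).comp
    (adjointTractor c x).subtype

theorem evalSlots_injective (c : Structure n M) (g : c.metrics) (x : M) :
    Function.Injective (evalSlots c g x) := fun _ _ h => adjointTractor_ext g h

/-- By `rescale_mem_spanB` the conditions for the different metrics are equivalent, so their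
intersection reduces to any single one. -/
theorem IsOrientedCurve.mem_bundleB_iff (h : IsOrientedCurve n γ I) {c : Structure n M}
    (g : c.metrics) {r : ℝ} (hr : r ∈ I) {Φ : adjointTractor c (γ r)} :
    Φ ∈ bundleB c γ r ↔ Φ.1 g ∈ spanB g.1 γ r := by
  rw [bundleB, Submodule.mem_iInf]
  refine ⟨fun hΦ => hΦ g, fun hΦ g' => ?_⟩
  obtain ⟨Ω, hΩ⟩ := (c.mem_iff g.1 g.2 g'.1).mp g'.2
  show Φ.1 g' ∈ spanB g'.1 γ r
  rw [Φ.2.2 g g' Ω hΩ]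
  exact h.rescale_mem_spanB hΩ hr hΦ

theorem IsOrientedCurve.map_bundleB [NeZero n] (h : IsOrientedCurve n γ I) {c : Structure n M}
    (g : c.metrics) {r : ℝ} (hr : r ∈ I) :
    (bundleB c γ r).map (evalSlots c g (γ r)) = spanB g.1 γ r := by
  ext t
  constructor
  · rintro ⟨Φ, hΦ, rfl⟩
    exact (h.mem_bundleB_iff g hr).mp hΦ
  · intro ht
    refine ⟨ofSlots c g (γ r) t (spanB_skew ht), (h.mem_bundleB_iff g hr).mpr ?_,
      ofSlots_self c g _ t (spanB_skew ht)⟩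
    rwa [ofSlots_self]

theorem IsOrientedCurve.finrank_spanB (h : IsOrientedCurve n γ I) (g : Metric n M) {r : ℝ}
    (hr : r ∈ I) : Module.finrank ℝ (spanB g γ r) = 3 := by
  have hU := h.unitCotangent_unitTangent g hr
  let e : Fin 3 → Slots (n := n) (γ r) := ![(0, 0, 0, unitCotangent g γ r),
    (0, 0, 1, acceleration g γ r),
    (unitCotangent g γ r, wedge (unitCotangent g γ r) (acceleration g γ r), 0, 0)]
  have he : LinearIndependent ℝ e := by
    rw [Fintype.linearIndependent_iff]
    intro k hk
    rw [Fin.sum_univ_three] at hk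
    -- The first slot contracted with U isolates `k 2`, the third slot is `k 1`, and the fourth
    -- contracted with U leaves `k 0` once `k 1` is zero.
    have h1 := congrArg (fun t : Slots (n := n) (γ r) => t.1 (unitTangent g γ r)) hk
    have h2 := congrArg (fun t : Slots (n := n) (γ r) => t.2.2.1) hk
    have h3 := congrArg (fun t : Slots (n := n) (γ r) => t.2.2.2 (unitTangent g γ r)) hk
    simp [e, hU] at h1 h2 h3
    simp [h2] at h3
    intro i
    fin_cases i
    · exact h3
    · exact h2
    · exact h1
  have hspan : spanB g γ r = Submodule.span ℝ (Set.range e) := by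
    rw [spanB]
    congr 1
    simp only [e, Matrix.range_cons, Matrix.range_empty, Set.union_empty]
    rfl
  rw [hspan, finrank_span_eq_card he, Fintype.card_fin]

theorem IsOrientedCurve.finrank_bundleB [NeZero n] (h : IsOrientedCurve n γ I)
    (c : Structure n M) {r : ℝ} (hr : r ∈ I) : Module.finrank ℝ (bundleB c γ r) = 3 := by
  obtain ⟨g₀, hg₀⟩ := c.nonempty
  let g : c.metrics := ⟨g₀, hg₀⟩
  rw [(Submodule.equivMapOfInjective _ (evalSlots_injective c g (γ r))
    (bundleB c γ r)).finrank_eq, h.map_bundleB g hr, h.finrank_spanB g.1 hr]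

/-! ### The tractor derivative of sections of the subbundle -/

/-- The heart of the proof: the right side is an element of the span plus the two terms in J. In the
second slot, the P-term of m U∧∂A cancels the tractor term P(U, ·)∧σ. -/
theorem IsOrientedCurve.delSlots_eq (h : IsOrientedCurve n γ I) {c : Structure n M}
    (g : c.metrics) {r : ℝ} (hr : r ∈ I) {t : ∀ s, Slots (n := n) (γ s)} {k l m : ℝ → ℝ}
    (hk : DifferentiableAt ℝ k r) (hl : DifferentiableAt ℝ l r) (hm : DifferentiableAt ℝ m r)
    (ht : ∀ᶠ s in 𝓝 r, t s = (m s • unitCotangent g.1 γ s,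
      m s • wedge (unitCotangent g.1 γ s) (acceleration g.1 γ s), l s,
      k s • unitCotangent g.1 γ s + l s • acceleration g.1 γ s)) :
    delSlots c g γ t r =
      ((delFun g.1 γ m r - l r) • unitCotangent g.1 γ r,
       (delFun g.1 γ m r - l r) • wedge (unitCotangent g.1 γ r) (acceleration g.1 γ r)
        + m r • wedge (unitCotangent g.1 γ r) (normalisedJerk c g γ r),
       delFun g.1 γ l r + k r + m r * rhoU c g γ r (unitTangent g.1 γ r),
       (delFun g.1 γ k r - m r * acceleration g.1 γ r (sharp g.1 (rhoU c g γ r))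
          - l r * (coInner g.1 (acceleration g.1 γ r) (acceleration g.1 γ r)
            + rhoU c g γ r (unitTangent g.1 γ r))) • unitCotangent g.1 γ r
        + (delFun g.1 γ l r + k r + m r * rhoU c g γ r (unitTangent g.1 γ r))
            • acceleration g.1 γ r
        + l r • normalisedJerk c g γ r) := by
  have hx : γ r ∈ (chartAt (Coord n) (γ r)).source := mem_chart_source _ _
  have hU := (h.contDiffAt_unitCotangent g.1 hr hx).differentiableAt (by simp)
  have hA := (h.contDiffAt_acceleration g.1 hr hx).differentiableAt (by simp)
  have hUU := h.unitCotangent_unitTangent g.1 hr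
  have hAU := h.acceleration_unitTangent g.1 hr
  have hdU : delCov g.1 γ (unitCotangent g.1 γ) r = acceleration g.1 γ r := rfl
  have hkU : DifferentiableAt ℝ (fun s => covComponents (γ r) (k s • unitCotangent g.1 γ s)) r :=
    hk.smul hU
  have hlA : DifferentiableAt ℝ (fun s => covComponents (γ r) (l s • acceleration g.1 γ s)) r :=
    hl.smul hA
  have h1 : delCov g.1 γ (fun s => (t s).1) r = _ :=
    (delCov_congr g.1 (ht.mono fun s hs => by rw [hs])).trans (delCov_smul g.1 hm hU)
  have h2 : delBil g.1 γ (fun s => (t s).2.1) r = _ :=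
    (delBil_congr g.1 (ht.mono fun s hs => by rw [hs])).trans
      (delBil_smul g.1 hm (differentiableAt_wedge hU hA))
  have h3 : delFun g.1 γ (fun s => (t s).2.2.1) r = delFun g.1 γ l r :=
    delFun_congr g.1 (ht.mono fun s hs => by rw [hs])
  have h4 : delCov g.1 γ (fun s => (t s).2.2.2) r = _ :=
    (delCov_congr g.1 (ht.mono fun s hs => by rw [hs])).trans
      (delCov_add g.1 hkU hlA)
  rw [delCov_smul g.1 hk hU, delCov_smul g.1 hl hA] at h4
  rw [delBil_wedge g.1 hU hA, hdU, wedge_self, zero_add] at h2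
  rw [hdU] at h1 h4
  have hJ : delCov g.1 γ (acceleration g.1 γ) r = normalisedJerk c g γ r
      - (coInner g.1 (acceleration g.1 γ r) (acceleration g.1 γ r)
        + rhoU c g γ r (unitTangent g.1 γ r)) • unitCotangent g.1 γ r + rhoU c g γ r := by
    rw [normalisedJerk]
    abel
  rw [hJ] at h2 h4
  have hsh := unitCotangent_sharp g.1 γ r (rhoU c g γ r)
  simp only [delSlots, h1, h2, h3, h4]
  rw [ht.self_of_nhds]
  refine Prod.ext ?_ (Prod.ext ?_ (Prod.ext ?_ ?_))
  · ext u
    simp [hUU, hAU]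
    ring
  · ext u v
    simp
    ring
  · simp [hUU, hAU, sharp_smul]
  · ext u
    simp [hsh]
    ring

theorem IsOrientedCurve.contDiffAt_covComponents_differential (h : IsOrientedCurve n γ I)
    {f : M → ℝ} (hf : ContMDiff (𝓡 n) 𝓘(ℝ, ℝ) ∞ f) {r : ℝ} (hr : r ∈ I) {x₀ : M}
    (hx : γ r ∈ (chartAt (Coord n) x₀).source) :
    ContDiffAt ℝ ∞ (fun t => covComponents x₀ (differential (n := n) f (γ t))) r := by
  have h1 : ContDiffAt ℝ ∞ (fun y => f ((extChartAt (𝓡 n) x₀).symm y))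
      (extChartAt (𝓡 n) x₀ (γ r)) := by
    rw [← contMDiffAt_iff_contDiffAt]
    exact ContMDiffAt.comp (I' := 𝓡 n) _ hf.contMDiffAt
      ((contMDiffOn_extChartAt_symm x₀).contMDiffAt (eventually_mem_target hx))
  refine ((h1.fderiv_right (m := ∞) (by simp)).comp r
    (h.contDiffAt_coord hr hx)).congr_of_eventuallyEq ?_
  filter_upwards [h.eventually_mem_source hr hx] with t ht
  exact (hasFDerivAt_comp_extChartAt_symm ht.2 (hf.mdifferentiableAt (by simp))).fderiv.symm

/-- A section is smooth if its slots are smooth in every metric; for the test section (0, 0, 1, A)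
the slots in another metric involve Υ. -/
theorem IsOrientedCurve.contDiffAt_upsilon (h : IsOrientedCurve n γ I)
    {g g' : Metric n M} {Ω : M → ℝ} (hΩ : IsConformalFactor g g' Ω) {r : ℝ} (hr : r ∈ I) {x₀ : M}
    (hx : γ r ∈ (chartAt (Coord n) x₀).source) :
    ContDiffAt ℝ ∞ (fun t => covComponents x₀ (upsilon (n := n) Ω (γ t))) r := by
  have h1 : ContDiffAt ℝ ∞ (fun t => Ω (γ t)) r := by
    rw [← contMDiffAt_iff_contDiffAt]
    exact ContMDiffAt.comp (I' := 𝓡 n) r hΩ.smooth.contMDiffAt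
      (h.smooth.contMDiffAt (h.isOpen.mem_nhds hr))
  exact (h1.inv (hΩ.pos _).ne').smul (h.contDiffAt_covComponents_differential hΩ.smooth hr hx)

theorem covComponents_zero (x₀ x : M) : covComponents x₀ (0 : Cov (n := n) x) = 0 :=
  ContinuousLinearMap.zero_comp _

theorem bilComponents_zero (x₀ x : M) : bilComponents x₀ (0 : Bil (n := n) x) = 0 := by
  ext u v
  rfl

theorem rescale_acceleration (g : Metric n M) (γ : ℝ → M) (Ω : M → ℝ) (r : ℝ) :
    rescale g Ω (γ r) (0, 0, 1, acceleration g γ r)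
      = (0, 0, 1, acceleration g γ r - upsilon Ω (γ r)) := by
  refine Prod.ext ?_ (Prod.ext ?_ (Prod.ext ?_ ?_))
  · simp [rescale]
  · simp [rescale, wedge]
  · simp [rescale, coInner]
  · simp [rescale, coInner]

theorem IsOrientedCurve.normalisedJerk_eq_zero_of_preservesB [NeZero n]
    (h : IsOrientedCurve n γ I) {c : Structure n M} {g : c.metrics} (hB : PreservesB c g γ I) :
    IsConformalCircle c g γ I := by
  intro r hr
  let Φ : ∀ s, adjointTractor c (γ s) := fun s =>
    ofSlots c g (γ s) (0, 0, 1, acceleration g.1 γ s) (fun u => by simp)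
  have hΦg : ∀ s, (Φ s).1 g = (0, 0, 1, acceleration g.1 γ s) := fun s => ofSlots_self _ _ _ _ _
  have hsmooth : SmoothSection c γ I Φ := by
    intro g' s hs
    have hx : γ s ∈ (chartAt (Coord n) (γ s)).source := mem_chart_source _ _
    have hΩ := conformalFactor_spec c g g'
    have hΦ : ∀ t, (Φ t).1 g'
        = (0, 0, 1, acceleration g.1 γ t - upsilon (conformalFactor c g g') (γ t)) := fun t => by
      rw [← rescale_acceleration]
      exact ofSlots_apply c g g' _ _ _ hΩ
    simp only [hΦ, covComponents_zero, bilComponents_zero]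
    exact ⟨contDiffAt_const, contDiffAt_const, contDiffAt_const,
      (h.contDiffAt_acceleration g.1 hs hx).sub (h.contDiffAt_upsilon hΩ hs hx)⟩
  have hmem : ∀ s ∈ I, Φ s ∈ bundleB c γ s := fun s hs => by
    rw [h.mem_bundleB_iff g hs, hΦg, mem_spanB_iff]
    exact ⟨0, 1, 0, by simp⟩
  obtain ⟨Ψ, hΨ, hΨB⟩ := hB Φ hsmooth hmem r hr
  -- With coefficients (0, 1, 0) the derivative has third slot 0, and its fourth slot is J plus a
  -- multiple of U.
  rw [h.mem_bundleB_iff g hr, hΨ, h.delSlots_eq g hr (k := fun _ => 0) (l := fun _ => 1)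
    (m := fun _ => 0) (by simp) (by simp) (by simp)
    (Filter.Eventually.of_forall fun s => by simp [hΦg]), mem_spanB_iff] at hΨB
  obtain ⟨k, l, m, heq⟩ := hΨB
  -- A vanishing third slot excludes the generator that carries A, so J is a multiple of U, and
  -- contraction with U shows that the multiple is 0.
  have hl : l = 0 := by
    have := congrArg (fun t : Slots (n := n) (γ r) => t.2.2.1) heq
    simpa [delFun] using this.symm
  have h4 := congrArg (fun t : Slots (n := n) (γ r) => t.2.2.2) heq
  simp only [hl, delFun, deriv_const] at h4
  have h5 : normalisedJerk c g γ r = (k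
      + (coInner g.1 (acceleration g.1 γ r) (acceleration g.1 γ r)
        + rhoU c g γ r (unitTangent g.1 γ r))) • unitCotangent g.1 γ r := by
    ext u
    have := congrArg (fun α : Cov (n := n) (γ r) => α u) h4
    simp at this
    simp
    linarith
  have h6 := h.normalisedJerk_unitTangent c g hr
  rw [h5, smul_apply, h.unitCotangent_unitTangent g.1 hr, smul_eq_mul, mul_one] at h6
  rw [h5, h6, zero_smul]

theorem IsOrientedCurve.preservesB_of_normalisedJerk_eq_zero [NeZero n]
    (h : IsOrientedCurve n γ I) {c : Structure n M} {g : c.metrics}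
    (hJ : IsConformalCircle c g γ I) : PreservesB c g γ I := by
  intro Φ hΦ hmem r hr
  have hx : γ r ∈ (chartAt (Coord n) (γ r)).source := mem_chart_source _ _
  have hU := (h.contDiffAt_unitComponents g.1 hr hx).differentiableAt (by simp)
  have hcontr : ∀ {α : ∀ s, Cov (n := n) (γ s)},
      ContDiffAt ℝ ∞ (fun s => covComponents (γ r) (α s)) r →
      DifferentiableAt ℝ (fun s => α s (unitTangent g.1 γ s)) r := fun {α} hα => by
    refine ((hα.differentiableAt (by simp)).clm_apply hU).congr_of_eventuallyEq ?_
    filter_upwards [h.eventually_mem_source hr hx] with s hs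
    exact (covComponents_components hs.2 _ _).symm
  obtain ⟨h1, -, h3, h4⟩ := hΦ g r hr
  -- Membership in the span only gives coefficients pointwise. Contraction with U, using U·U = 1 and
  -- A·U = 0, exhibits them as differentiable functions of s.
  have ht : ∀ᶠ s in 𝓝 r, (Φ s).1 g = (((Φ s).1 g).1 (unitTangent g.1 γ s)
        • unitCotangent g.1 γ s,
      ((Φ s).1 g).1 (unitTangent g.1 γ s)
        • wedge (unitCotangent g.1 γ s) (acceleration g.1 γ s), ((Φ s).1 g).2.2.1,
      ((Φ s).1 g).2.2.2 (unitTangent g.1 γ s) • unitCotangent g.1 γ s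
        + ((Φ s).1 g).2.2.1 • acceleration g.1 γ s) := by
    filter_upwards [h.isOpen.mem_nhds hr] with s hs
    obtain ⟨k, l, m, hklm⟩ := (mem_spanB_iff _ _ _ _).mp
      ((h.mem_bundleB_iff g hs).mp (hmem s hs))
    rw [hklm]
    simp [h.unitCotangent_unitTangent g.1 hs, h.acceleration_unitTangent g.1 hs]
  have hd := h.delSlots_eq g hr (hcontr h4) (h3.differentiableAt (by simp)) (hcontr h1) ht
  have hspan : delSlots c g γ (fun s => (Φ s).1 g) r ∈ spanB g.1 γ r := by
    rw [hd, mem_spanB_iff, hJ r hr]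
    simp only [smul_zero, add_zero, wedge_zero]
    exact ⟨_, _, _, rfl⟩
  refine ⟨ofSlots c g (γ r) _ (spanB_skew hspan), ofSlots_self _ _ _ _ _, ?_⟩
  rw [h.mem_bundleB_iff g hr, ofSlots_self]
  exact hspan

end BundleB

end ConformalCircles

end

theorem mainTheorem3 (n : ℕ) (hn : 2 ≤ n) (M : Type*) [TopologicalSpace M]
    [ChartedSpace (EuclideanSpace ℝ (Fin n)) M] [IsManifold (𝓡 n) ∞ M]
    (c : ConformalCircles.Structure n M) (γ : ℝ → M) (I : Set ℝ)
    (hγ : ConformalCircles.IsOrientedCurve n γ I) :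
    (∀ s ∈ I, Module.finrank ℝ (ConformalCircles.bundleB c γ s) = 3) ∧
    ∀ g : c.metrics,
      ConformalCircles.PreservesB c g γ I ↔ ConformalCircles.IsConformalCircle c g γ I := by
  -- A positive dimension provides the nonzero tangent vectors on which uniqueness of conformal
  -- factors depends.
  have : NeZero n := ⟨by lia⟩
  exact ⟨fun s hs => hγ.finrank_bundleB c hs, fun g =>
    ⟨hγ.normalisedJerk_eq_zero_of_preservesB, hγ.preservesB_of_normalisedJerk_eq_zero⟩⟩
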